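/- **Kac–Rice formula in the Euclidean-mode setting, multidimensional case.** Let $d\ge 2$, let $\mathcal X\subseteq\mathbb R^d$ be open and let $\mathcal Y$ be a finite set of modes. For each $y\in\mathcal Y$ let $r_y:\mathcal X\to\mathbb R^d$ be a continuously differentiable vector field such that for every $\zeta\in\mathcal X$ the initial value problem $x'=r_y(x)$, $x(0)=\zeta$ has a solution $\phi_y(\zeta,\cdot)$ in $\mathcal X$ defined on all of $\mathbb R$. On a probability space let $(T_n,M_n)_{n\ge0}$, with marks $M_n=(M_{X,n},M_{Y,n})$, be a marked point process on $\mathbb R_+\times(\mathcal X\times\mathcal Y)$ such that almost surely $0=T_0<T_1\le T_2\le\dots$ and $T_n\to\infty$, and such that $\mathbb E\,\#\{n: T_n\le t\}<\infty$ for all $t$. Let $(X,Y)$ be the piecewise smooth process $$(X(t),Y(t))=\bigl(\phi_{M_{Y,n}}(M_{X,n},\,t-T_n),\,M_{Y,n}\bigr)\qquad (T_n\le t<T_{n+1}).$$ Let $D\subseteq\mathcal X$ be a bounded open set whose boundary $S=\partial D$ is contained in $\mathcal X$, and let $\rho:\mathbb R^d\to\mathbb R$ be a $\mathcal C^1$ defining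 function of $D$, that is, $D=\{x\in\mathcal X:\rho(x)<0\}$, $\mathcal X\setminus\overline D=\{x\in\mathcal X:\rho(x)>0\}$ and $\nabla\rho\ne0$ on $S$. Let $\nu=\nabla\rho/\|\nabla\rho\|$ be the outward unit normal on $S$. A trajectory $z$ has a *continuous crossing* of $S$ at time $s>0$ if $z(s^-)=z(s)\in S$ and there is $\delta>0$ with $z(t)\notin S$ for all $t\in(s-\delta,s+\delta)\setminus\{s\}$. For a time horizon $H\ge0$ let $c_S(H)$ be the number of continuous crossings of $S$ by $X$ within $[0,H]$, and $C_S(H)=\mathbb E[c_S(H)]$. Assume: 1. for every mode $y$, $(r_y(x),\nu(x))\ne0$ for all $x\in S$, and the number of continuous crossings of $S$ within $[0,H]$ by $\phi_y(x,\cdot)$ is bounded uniformly in $x\in\mathcal X$; 2. almost surely $X$ does not jump from or to $S$ within $(0,H]$, i.e. whenever $X(s^-)\ne X(s)$, neither $X(s^-)$ nor $X(s)$ is in $S$; 3. for every $t\in[0,H]$, $(X(t),Y(t))$ has a density $p_{(X(t),Y(t))}(x,y)$ with respect to the product of the Lebesgue measure on $\mathbb R^d$ and the counting measure on $\mathcal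 Y$, and for every $y$ the map $(x,t)\mapsto p_{(X(t),Y(t))}(x,y)$ is continuous on $\mathcal V\times[0,H]$ for some open neighborhood $\mathcal V$ of $S$. Then $c_S(H)$ is measurable up to a null set, $C_S(H)$ is finite, and $$C_S(H)=\sum_{y\in\mathcal Y}\int_S|(r_y(x),\nu(x))|\int_0^H p_{(X(s),Y(s))}(x,y)\,ds\,\sigma_{d-1}(dx),$$ where $\sigma_{d-1}$ is the $(d-1)$-dimensional Hausdorff measure (normalized as surface measure). -/

import Mathlib

open MeasureTheory Set Filter Topology
open scoped ENNReal NNReal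

noncomputable section

namespace PiecewiseSmooth

variable {E 𝒴 Ω : Type*}

/-- `r y` is a continuously differentiable vector field on `𝒳` for each mode `y`, and `φ y ζ` is the
solution of `x' = r y x`, `x 0 = ζ`, which exists for all times and stays in `𝒳`. (Uniqueness of the
solution and the flow property follow from the regularity of `r y`.) -/
structure IsModeFlow [NormedAddCommGroup E] [NormedSpace ℝ E]
    (𝒳 : Set E) (r : 𝒴 → E → E) (φ : 𝒴 → E → ℝ → E) : Prop where
  contDiffOn : ∀ y, ContDiffOn ℝ 1 (r y) 𝒳
  mem : ∀ y, ∀ ζ ∈ 𝒳, ∀ t, φ y ζ t ∈ 𝒳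
  initial : ∀ y, ∀ ζ ∈ 𝒳, φ y ζ 0 = ζ
  hasDerivAt : ∀ y, ∀ ζ ∈ 𝒳, ∀ t, HasDerivAt (φ y ζ) (r y (φ y ζ t)) t

/-- The jump times `T n` and the marks `M n` form a marked point process on `ℝ₊ × (𝒳 × 𝒴)`: almost
surely `T 0 = 0 < T 1 ≤ T 2 ≤ …`, `T n → ∞`, and all Euclidean marks lie in `𝒳`. -/
structure IsMarkedPointProcess [MeasurableSpace Ω] [MeasurableSpace E] [MeasurableSpace 𝒴]
    (P : Measure Ω) (𝒳 : Set E) (T : ℕ → Ω → ℝ) (M : ℕ → Ω → E × 𝒴) : Prop where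
  measurable_time : ∀ n, Measurable (T n)
  measurable_mark : ∀ n, Measurable (M n)
  mark_mem : ∀ᵐ ω ∂P, ∀ n, (M n ω).1 ∈ 𝒳
  time_zero : ∀ᵐ ω ∂P, T 0 ω = 0
  time_one_pos : ∀ᵐ ω ∂P, 0 < T 1 ω
  time_mono : ∀ᵐ ω ∂P, Monotone fun n => T n ω
  time_tendsto : ∀ᵐ ω ∂P, Tendsto (fun n => T n ω) atTop atTop

/-- The expected number of jump times in `[0, t]` is finite for every `t`. -/
def HasFiniteExpectedJumps [MeasurableSpace Ω] (P : Measure Ω) (T : ℕ → Ω → ℝ) : Prop :=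
  ∀ t : ℝ, ∫⁻ ω, (({n : ℕ | T n ω ≤ t}.encard : ℕ∞) : ℝ≥0∞) ∂P < ∞

/-- The index of the last jump that occurred up to time `t`, that is, the largest `n` with
`T n ω ≤ t`; when `T n ω` is nondecreasing, it is the `n` with `T n ω ≤ t < T (n + 1) ω`. -/
def jumpIndex (T : ℕ → Ω → ℝ) (t : ℝ) (ω : Ω) : ℕ :=
  sSup {n : ℕ | T n ω ≤ t}

/-- The Euclidean component of the process: on `[T n, T (n + 1))` it follows the flow of the current
mode, started at time `T n` from the Euclidean mark. -/
def euclideanPart (φ : 𝒴 → E → ℝ → E) (T : ℕ → Ω → ℝ) (M : ℕ → Ω → E × 𝒴) (t : ℝ) (ω : Ω) : E :=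
  φ (M (jumpIndex T t ω) ω).2 (M (jumpIndex T t ω) ω).1 (t - T (jumpIndex T t ω) ω)

/-- The mode component of the process: on `[T n, T (n + 1))` it is the mode mark. -/
def modePart (T : ℕ → Ω → ℝ) (M : ℕ → Ω → E × 𝒴) (t : ℝ) (ω : Ω) : 𝒴 :=
  (M (jumpIndex T t ω) ω).2

/-- `S` is the boundary of the bounded open set `D ⊆ 𝒳`, it is contained in `𝒳`, and `ρ` is a
continuously differentiable defining function of `D`: negative exactly on `D`, positive exactly on
the complement of the closure of `D` (within `𝒳`), with nonzero gradient on `S`. -/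
structure IsCrossingSurface [NormedAddCommGroup E] [InnerProductSpace ℝ E] [CompleteSpace E]
    (𝒳 D S : Set E) (ρ : E → ℝ) : Prop where
  bounded : Bornology.IsBounded D
  boundary : S = frontier D
  boundary_subset : S ⊆ 𝒳
  contDiff : ContDiff ℝ 1 ρ
  interior_eq : D = {x ∈ 𝒳 | ρ x < 0}
  exterior_eq : 𝒳 \ closure D = {x ∈ 𝒳 | 0 < ρ x}
  gradient_ne_zero : ∀ x ∈ S, gradient ρ x ≠ 0

/-- The outward unit normal `∇ρ / ‖∇ρ‖`. -/
def unitNormal [NormedAddCommGroup E] [InnerProductSpace ℝ E] [CompleteSpace E]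
    (ρ : E → ℝ) (x : E) : E :=
  ‖gradient ρ x‖⁻¹ • gradient ρ x

/-- The trajectory `z` has a continuous crossing of `S` at time `s > 0`: `z(s⁻) = z(s) ∈ S` and
`z` is not in `S` at all other times close to `s`. -/
def IsContinuousCrossing [TopologicalSpace E] (S : Set E) (z : ℝ → E) (s : ℝ) : Prop :=
  0 < s ∧ Tendsto z (𝓝[<] s) (𝓝 (z s)) ∧ z s ∈ S ∧
    ∃ δ > 0, ∀ t ∈ Ioo (s - δ) (s + δ) \ {s}, z t ∉ S

/-- The number of continuous crossings of `S` by the trajectory `z` within `[0, H]`. -/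
def crossingCount [TopologicalSpace E] (S : Set E) (z : ℝ → E) (H : ℝ) : ℕ∞ :=
  {s ∈ Icc 0 H | IsContinuousCrossing S z s}.encard

/-- The expected number of continuous crossings of `S` by the process `X` within `[0, H]`. -/
def expectedCrossings [TopologicalSpace E] [MeasurableSpace Ω] (P : Measure Ω)
    (S : Set E) (X : ℝ → Ω → E) (H : ℝ) : ℝ≥0∞ :=
  ∫⁻ ω, ((crossingCount S (fun t => X t ω) H : ℕ∞) : ℝ≥0∞) ∂P

/-- The law of `(X t, Y t)` has density `p` with respect to the product of the Lebesgue measure and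
the counting measure. -/
def HasModeDensity [MeasureSpace E] [MeasurableSpace Ω] (P : Measure Ω)
    (X : Ω → E) (Y : Ω → 𝒴) (p : E → 𝒴 → ℝ≥0) : Prop :=
  ∀ y, Measurable (fun x => p x y) ∧
    ∀ A : Set E, MeasurableSet A → P {ω | X ω ∈ A ∧ Y ω = y} = ∫⁻ x in A, (p x y : ℝ≥0∞)

/-- Almost surely, `X` does not jump from or to `S` within `(0, H]`: whenever the left limit of `X`
at `s` differs from `X s`, neither of the two points lies in `S`. -/
def NoJumpFromOrTo [TopologicalSpace E] [MeasurableSpace Ω] (P : Measure Ω)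
    (S : Set E) (X : ℝ → Ω → E) (H : ℝ) : Prop :=
  ∀ᵐ ω ∂P, ∀ s ∈ Ioc 0 H, ∀ x₀ : E, Tendsto (fun t => X t ω) (𝓝[<] s) (𝓝 x₀) →
    x₀ ≠ X s ω → x₀ ∉ S ∧ X s ω ∉ S

end PiecewiseSmooth

end

/-!
The number of continuous crossings is approximated pathwise. Divide `[0, H]` into `N` steps of
length `h = H / N` and count the steps in which the flow of the current mode, started at the state
of the process at the left end of the step, reaches `S` within time `h`. Each continuous crossing
is the arrival in `S` of the trajectory followed just before it
(`isContinuousCrossing_iff_piece_mem`; this covers a mode change on `S`, because the process does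
not jump from or to `S` and the flows are transversal to `S`). Hence for almost every path the
count equals the number of crossings once `N` is large (`eventually_card_reachingSteps_eq`), and
it is at most a constant times the number of jumps up to time `H` (`card_reachingSteps_le`), which
is integrable. By dominated convergence the expected number of crossings is the limit of the
expected counts.

The flow of mode `y` reaches `S` from `x` within time `h` exactly when `x` lies in the tube swept
out by `S` under the backward flow during `(0, h]`. So the expected count is the sum over the
modes and the steps of the integral of the density over this tube, and what remains is geometry:
the volume on a thin tube, divided by `h`, converges to the surface measure on `S` weighted by the
normal speed `|(r y x, ν x)|` (`fluxMeasure`). Locally this needs neither a parametrization of `S`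
nor an area formula (`exists_volume_tube_near`). As `S` is contained in a level set of `ρ`, the
orthogonal projection of a small piece of `S` to the tangent plane changes distances, and
therefore Hausdorff measure, by a factor close to one. In the coordinates given by this projection
and the time, the flow is close, in the Lipschitz sense, to a linear map with determinant
`±(r y x, ν x)`, so it changes volumes by a factor close to the absolute value of that
determinant. Compactness of `S` and uniform continuity of the densities turn this into the
convergence of the sums (`tendsto_sum_flowTube`).

Measurability is obtained from the densities: the outer measures of the events `X t ∈ A`,
`Y t = y` and `X t ∉ A`, `Y t = y` add up to the probability of `Y t = y`, and this forces both
events to be null-measurable (`nullMeasurableSet_inter_of_measure_add_le`), without any joint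
measurability of the flows.
-/

namespace PiecewiseSmooth

/-! ### Flows of continuously differentiable vector fields -/

section Flow

variable {E 𝒴 : Type*} [NormedAddCommGroup E] [NormedSpace ℝ E]

/-- Global uniqueness for an autonomous equation with a continuously differentiable right-hand
side: the set of times at which two solutions agree is open and closed. -/
theorem eq_of_hasDerivAt_of_eq {𝒳 : Set E} (h𝒳 : IsOpen 𝒳) {v : E → E}
    (hv : ContDiffOn ℝ 1 v 𝒳) {f g : ℝ → E} (hf𝒳 : ∀ t, f t ∈ 𝒳)
    (hf : ∀ t, HasDerivAt f (v (f t)) t) (hg : ∀ t, HasDerivAt g (v (g t)) t)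
    {t₀ : ℝ} (h₀ : f t₀ = g t₀) : f = g := by
  have hfc : Continuous f := continuous_iff_continuousAt.2 fun t => (hf t).continuousAt
  have hgc : Continuous g := continuous_iff_continuousAt.2 fun t => (hg t).continuousAt
  have hclopen : IsClopen {t | f t = g t} := by
    refine ⟨isClosed_eq hfc hgc, isOpen_iff_mem_nhds.2 fun t ht => ?_⟩
    obtain ⟨K, U, hU, hK⟩ :=
      (hv.contDiffAt (h𝒳.mem_nhds (hf𝒳 t))).exists_lipschitzOnWith
    refine ODE_solution_unique_of_eventually (v := fun _ => v) (s := fun _ => U) (K := K)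
      (Eventually.of_forall fun _ => hK) ?_ ?_ ht
    · filter_upwards [hfc.continuousAt hU] with s hs using ⟨hf s, hs⟩
    · have hU' : U ∈ 𝓝 (g t) := by
        have : f t = g t := ht
        rwa [← this]
      filter_upwards [hgc.continuousAt hU'] with s hs using ⟨hg s, hs⟩
  have huniv : {t | f t = g t} = univ := hclopen.eq_univ ⟨t₀, h₀⟩
  exact funext fun t => (huniv ▸ mem_univ t : t ∈ {t | f t = g t})

theorem IsModeFlow.flow_add {𝒳 : Set E} {r : 𝒴 → E → E} {φ : 𝒴 → E → ℝ → E}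
    (hφ : IsModeFlow 𝒳 r φ) (h𝒳 : IsOpen 𝒳) (y : 𝒴) {x : E} (hx : x ∈ 𝒳) (s t : ℝ) :
    φ y (φ y x s) t = φ y x (s + t) := by
  have hxs := hφ.mem y x hx s
  refine congrFun (eq_of_hasDerivAt_of_eq h𝒳 (hφ.contDiffOn y) (f := φ y (φ y x s))
    (g := fun t => φ y x (s + t)) (hφ.mem y _ hxs)
    (hφ.hasDerivAt y _ hxs) (fun t => ?_) (t₀ := 0) ?_) t
  · exact (hφ.hasDerivAt y x hx (s + t)).comp_const_add s t
  · simp [hφ.initial y _ hxs]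

theorem IsModeFlow.continuous_flow {𝒳 : Set E} {r : 𝒴 → E → E} {φ : 𝒴 → E → ℝ → E}
    (hφ : IsModeFlow 𝒳 r φ) (y : 𝒴) {x : E} (hx : x ∈ 𝒳) : Continuous (φ y x) :=
  continuous_iff_continuousAt.2 fun t => (hφ.hasDerivAt y x hx t).continuousAt

/-- For points near `x₀` and short times, a flow is, in the Lipschitz sense, close to the
straight motion `(z, s) ↦ z + s • v x₀`. -/
theorem exists_flow_linearization {𝒳 : Set E} (h𝒳 : IsOpen 𝒳) {v : E → E}
    (hv : ContDiffOn ℝ 1 v 𝒳) {ψ : E → ℝ → E} (hψ₀ : ∀ z ∈ 𝒳, ψ z 0 = z)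
    (hψ : ∀ z ∈ 𝒳, ∀ t, HasDerivAt (ψ z) (v (ψ z t)) t) {x₀ : E} (hx₀ : x₀ ∈ 𝒳)
    {η : ℝ} (hη : 0 < η) :
    ∃ δ > 0, ∀ z ∈ Metric.ball x₀ δ, ∀ z' ∈ Metric.ball x₀ δ, ∀ s ∈ Icc 0 δ, ∀ s' ∈ Icc 0 δ,
      ‖ψ z s - ψ z' s' - (z - z') - (s - s') • v x₀‖ ≤ η * (‖z - z'‖ + |s - s'|) := by
  have hat := hv.contDiffAt (h𝒳.mem_nhds hx₀)
  obtain ⟨K, U, hU, hK⟩ := hat.exists_lipschitzOnWith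
  have hnear : ∀ᶠ x in 𝓝 x₀, x ∈ U ∧ x ∈ 𝒳 ∧ ‖v x - v x₀‖ < η := by
    filter_upwards [hU, h𝒳.mem_nhds hx₀,
      (hat.continuousAt.eventually (Metric.ball_mem_nhds _ hη))] with x h1 h2 h3
    exact ⟨h1, h2, by simpa [dist_eq_norm] using h3⟩
  obtain ⟨R, hR, hball⟩ := Metric.eventually_nhds_iff_ball.1 hnear
  -- `C` exceeds the speed of the trajectories as long as they stay in the ball of radius `R`.
  set C : ℝ := ‖v x₀‖ + η + 1 with hC
  have hCpos : 0 < C := by positivity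
  obtain ⟨δ, hδ, hδ1, hδR, hδC, hδK⟩ :
      ∃ δ > 0, δ ≤ 1 ∧ δ ≤ R / 4 ∧ C * δ ≤ R / 4 ∧ K * Real.exp K * δ ≤ η := by
    have hB : 0 ≤ K * Real.exp K := by positivity
    refine ⟨min 1 (min (R / 4) (min (R / 4 / C) (η / (K * Real.exp K + 1)))),
      by positivity, min_le_left _ _, ?_, ?_, ?_⟩
    · exact (min_le_right _ _).trans (min_le_left _ _)
    · rw [mul_comm, ← le_div_iff₀ hCpos]
      exact (min_le_right _ _).trans ((min_le_right _ _).trans (min_le_left _ _))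
    · have h1 : min 1 (min (R / 4) (min (R / 4 / C) (η / (K * Real.exp K + 1)))) ≤
          η / (K * Real.exp K + 1) :=
        (min_le_right _ _).trans ((min_le_right _ _).trans (min_le_right _ _))
      calc K * Real.exp K * _ ≤ K * Real.exp K * (η / (K * Real.exp K + 1)) := by gcongr
        _ ≤ (K * Real.exp K + 1) * (η / (K * Real.exp K + 1)) := by
            gcongr; linarith
        _ = η := by field_simp
  have h𝒳ball : ∀ z ∈ Metric.ball x₀ δ, z ∈ 𝒳 := fun z hz =>
    (hball z (Metric.ball_subset_ball (by linarith) hz)).2.1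
  have hcont : ∀ z ∈ Metric.ball x₀ δ, Continuous (ψ z) := fun z hz =>
    continuous_iff_continuousAt.2 fun t => (hψ z (h𝒳ball z hz) t).continuousAt
  -- The trajectories do not leave the ball of radius `R` before time `δ`.
  have hstay : ∀ z ∈ Metric.ball x₀ δ, ∀ t ∈ Icc 0 δ, ψ z t ∈ Metric.ball x₀ R := by
    intro z hz t ht
    have hle : ∀ s, s ≤ δ → ‖ψ z s - z‖ ≤ C * s → ψ z s ∈ Metric.ball x₀ R := by
      intro s hs hsn
      rw [Metric.mem_ball, dist_eq_norm] at hz ⊢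
      have h1 : ‖ψ z s - x₀‖ ≤ ‖ψ z s - z‖ + ‖z - x₀‖ := norm_sub_le_norm_sub_add_norm_sub _ _ _
      have h2 : C * s ≤ C * δ := by gcongr
      linarith
    refine hle t ht.2 ?_
    refine image_norm_le_of_norm_deriv_right_lt_deriv_boundary (f := fun s => ψ z s - z)
      (f' := fun s => v (ψ z s)) (B := fun s => C * s) (B' := fun _ => C) (a := 0) (b := δ)
      ((hcont z hz).sub continuous_const).continuousOn
      (fun s _ => ((hψ z (h𝒳ball z hz) s).sub_const z).hasDerivWithinAt) ?_
      (fun s => by simpa using (hasDerivAt_id s).const_mul C) ?_ ht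
    · simp [hψ₀ z (h𝒳ball z hz)]
    · intro s hs hsn
      have h1 := (hball _ (hle s hs.2.le hsn.le)).2.2
      have h2 : ‖v (ψ z s)‖ ≤ ‖v (ψ z s) - v x₀‖ + ‖v x₀‖ := by
        simpa using norm_add_le (v (ψ z s) - v x₀) (v x₀)
      linarith
  refine ⟨δ, hδ, fun z hz z' hz' s hs s' hs' => ?_⟩
  have hz𝒳 := h𝒳ball z hz
  have hz𝒳' := h𝒳ball z' hz'
  -- Dependence on the initial point, by Grönwall's inequality.
  have hspace : ‖ψ z s - ψ z' s - (z - z')‖ ≤ η * ‖z - z'‖ := by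
    have hgr : ∀ t ∈ Icc 0 δ, dist (ψ z t) (ψ z' t) ≤ ‖z - z'‖ * Real.exp (K * (t - 0)) :=
      dist_le_of_trajectories_ODE_of_mem (v := fun _ => v) (s := fun _ => U) (K := K)
        (fun _ _ => hK) (hcont z hz).continuousOn
        (fun t _ => (hψ z hz𝒳 t).hasDerivWithinAt)
        (fun t ht => (hball _ (hstay z hz t ⟨ht.1, ht.2.le⟩)).1) (hcont z' hz').continuousOn
        (fun t _ => (hψ z' hz𝒳' t).hasDerivWithinAt)
        (fun t ht => (hball _ (hstay z' hz' t ⟨ht.1, ht.2.le⟩)).1)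
        (by rw [hψ₀ z hz𝒳, hψ₀ z' hz𝒳', dist_eq_norm])
    have hsub := norm_image_sub_le_of_norm_deriv_right_le_segment (a := 0) (b := δ)
      (f := fun t => ψ z t - ψ z' t) (f' := fun t => v (ψ z t) - v (ψ z' t))
      (C := K * Real.exp K * ‖z - z'‖)
      ((hcont z hz).sub (hcont z' hz')).continuousOn
      (fun t _ => ((hψ z hz𝒳 t).sub (hψ z' hz𝒳' t)).hasDerivWithinAt) (fun t ht => by
        have ht' : t ∈ Icc 0 δ := ⟨ht.1, ht.2.le⟩
        have h1 := hK.dist_le_mul _ (hball _ (hstay z hz t ht')).1 _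
          (hball _ (hstay z' hz' t ht')).1
        rw [dist_eq_norm] at h1
        have h2 : Real.exp (K * (t - 0)) ≤ Real.exp K := by
          rw [Real.exp_le_exp, sub_zero]
          exact mul_le_of_le_one_right K.2 (ht'.2.trans hδ1)
        calc _ ≤ (K : ℝ) * dist (ψ z t) (ψ z' t) := h1
          _ ≤ K * (‖z - z'‖ * Real.exp K) := by
              gcongr
              exact (hgr t ht').trans (by gcongr)
          _ = _ := by ring) s hs
    simp only [hψ₀ z hz𝒳, hψ₀ z' hz𝒳', sub_zero] at hsub
    calc _ ≤ K * Real.exp K * ‖z - z'‖ * s := hsub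
      _ ≤ K * Real.exp K * ‖z - z'‖ * δ := by gcongr; exact hs.2
      _ = K * Real.exp K * δ * ‖z - z'‖ := by ring
      _ ≤ _ := by gcongr
  have htime : ‖ψ z' s - ψ z' s' - (s - s') • v x₀‖ ≤ η * |s - s'| := by
    have := (convex_Icc (0 : ℝ) δ).norm_image_sub_le_of_norm_hasDerivWithin_le
      (f := fun t => ψ z' t - t • v x₀) (f' := fun t => v (ψ z' t) - v x₀) (C := η)
      (fun t _ => ((hψ z' hz𝒳' t).sub
        (by simpa using (hasDerivAt_id t).smul_const (v x₀))).hasDerivWithinAt)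
      (fun t ht => (hball _ (hstay z' hz' t ht)).2.2.le) hs' hs
    rw [Real.norm_eq_abs] at this
    convert this using 2
    rw [sub_smul]
    abel
  calc _ = ‖(ψ z s - ψ z' s - (z - z')) + (ψ z' s - ψ z' s' - (s - s') • v x₀)‖ := by
        congr 1; abel
    _ ≤ _ := norm_add_le _ _
    _ ≤ η * ‖z - z'‖ + η * |s - s'| := add_le_add hspace htime
    _ = _ := by ring

end Flow

/-! ### Euclidean Hausdorff measure and hyperplanes -/

section LocalTube

theorem euclideanHausdorffMeasure_image_le {X Z : Type*} [MetricSpace X] [MeasurableSpace X]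
    [BorelSpace X] [MetricSpace Z] [MeasurableSpace Z] [BorelSpace Z] {K : ℝ≥0} {f : X → Z}
    {s : Set X} (hf : LipschitzOnWith K f s) (n : ℕ) :
    μHE[n] (f '' s) ≤ (K : ℝ≥0∞) ^ n * μHE[n] s := by
  simp only [Measure.euclideanHausdorffMeasure_def, Measure.smul_apply]
  have h := hf.hausdorffMeasure_image_le (d := n) (by positivity)
  rw [ENNReal.rpow_natCast] at h
  rw [mul_smul_comm]
  gcongr

theorem euclideanHausdorffMeasure_le_image {X Z : Type*} [MetricSpace X] [MeasurableSpace X]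
    [BorelSpace X] [MetricSpace Z] [MeasurableSpace Z] [BorelSpace Z] {K : ℝ≥0} {f : X → Z}
    {s : Set X} (hf : ∀ x ∈ s, ∀ y ∈ s, dist x y ≤ K * dist (f x) (f y)) (n : ℕ) :
    μHE[n] s ≤ (K : ℝ≥0∞) ^ n * μHE[n] (f '' s) := by
  rcases s.eq_empty_or_nonempty with rfl | ⟨x₀, -⟩
  · simp
  have : Nonempty X := ⟨x₀⟩
  have hinj : InjOn f s := fun x hx y hy hxy => by
    have := hf x hx y hy
    rw [hxy, dist_self, mul_zero] at this
    exact dist_le_zero.1 this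
  have hinv := hinj.leftInvOn_invFunOn
  have hlip : LipschitzOnWith K (Function.invFunOn f s) (f '' s) := by
    refine LipschitzOnWith.of_dist_le_mul ?_
    rintro _ ⟨x, hx, rfl⟩ _ ⟨y, hy, rfl⟩
    rw [hinv hx, hinv hy]
    exact hf x hx y hy
  have := euclideanHausdorffMeasure_image_le hlip n
  rwa [hinv.image_image] at this

variable {E : Type*} [NormedAddCommGroup E] [InnerProductSpace ℝ E]

theorem coe_orthogonalProjectionOnto_orthogonal_span {ν : E} (hν : ‖ν‖ = 1) (w : E) :
    ((ℝ ∙ ν)ᗮ.orthogonalProjectionOnto w : E) = w - inner ℝ ν w • ν := by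
  rw [← Submodule.starProjection_apply, Submodule.starProjection_orthogonal_val,
    Submodule.starProjection_unit_singleton ℝ hν]

/-- The linear map that fixes the hyperplane orthogonal to the unit vector `ν` and sends `ν`
to `u`. -/
noncomputable def shearTo (ν u : E) : E →L[ℝ] E :=
  ContinuousLinearMap.id ℝ E + (innerSL ℝ ν).smulRight (u - ν)

theorem shearTo_apply (ν u w : E) : shearTo ν u w = w + inner ℝ ν w • (u - ν) := by
  simp [shearTo]

variable [FiniteDimensional ℝ E]

theorem det_shearTo {ν : E} (hν : ‖ν‖ = 1) (u : E) : (shearTo ν u).det = inner ℝ ν u := by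
  have h : ((shearTo ν u : E →L[ℝ] E) : E →ₗ[ℝ] E) =
      LinearMap.transvection ((innerSL ℝ ν : E →L[ℝ] ℝ) : E →ₗ[ℝ] ℝ) (u - ν) := by
    ext w
    simp [shearTo_apply, LinearMap.transvection.apply]
  rw [ContinuousLinearMap.det, h, LinearMap.transvection.det]
  simp [inner_sub_right, hν]

variable [MeasurableSpace E] [BorelSpace E]

/-- The cylinder of height `h` over a subset `B` of the hyperplane orthogonal to `ν`. Neither `B`
nor the cylinder needs to be measurable. -/
theorem volume_cylinder {ν : E} (hν : ‖ν‖ = 1) (B : Set (ℝ ∙ ν)ᗮ) (h : ℝ) :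
    volume {w : E | (ℝ ∙ ν)ᗮ.orthogonalProjectionOnto w ∈ B ∧ inner ℝ ν w ∈ Ioc 0 h} =
      ENNReal.ofReal h * volume B := by
  have hmp := (ℝ ∙ ν).measurePreserving_measurableEquivProd (0 : E)
  rw [InnerProductSpace.euclideanHausdorffMeasure_eq_volume] at hmp
  set I : Set (ℝ ∙ ν) := {c | inner ℝ ν (c : E) ∈ Ioc 0 h}
  have hI : volume I = ENNReal.ofReal h := by
    let e := LinearIsometryEquiv.toSpanUnitSingleton (𝕜 := ℝ) ν hν
    have he : e.toHomeomorph.toMeasurableEquiv ⁻¹' I = Ioc 0 h := by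
      ext t
      simp [I, e, inner_smul_right, hν]
    have hme : MeasurePreserving e.toHomeomorph.toMeasurableEquiv volume volume :=
      e.measurePreserving
    rw [← hme.measure_preimage_equiv, he]
    simp
  have hset : {w : E | (ℝ ∙ ν)ᗮ.orthogonalProjectionOnto w ∈ B ∧ inner ℝ ν w ∈ Ioc 0 h} =
      (ℝ ∙ ν).measurableEquivProd (0 : E) ⁻¹' (I ×ˢ B) := by
    ext w
    have hw : inner ℝ ν ((ℝ ∙ ν).orthogonalProjectionOnto w : E) = inner ℝ ν w := by
      rw [← Submodule.starProjection_apply, Submodule.starProjection_unit_singleton ℝ hν,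
        inner_smul_right, real_inner_self_eq_norm_sq, hν]
      simp
    simp only [Submodule.measurableEquivProd_apply, vsub_eq_sub, sub_zero, mem_preimage, mem_prod,
      mem_ofPred_eq, I, hw]
    exact and_comm
  rw [hset, hmp.measure_preimage_equiv, Measure.volume_eq_prod, Measure.prod_prod, hI]

theorem volume_orthogonal_eq {ν : E} (hν : ‖ν‖ = 1) (B : Set (ℝ ∙ ν)ᗮ) :
    volume B = μHE[Module.finrank ℝ E - 1] B := by
  have hν0 : ν ≠ 0 := by
    rintro rfl
    simp at hν
  have h1 := (ℝ ∙ ν).finrank_add_finrank_orthogonal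
  rw [finrank_span_singleton hν0] at h1
  have h2 : Module.finrank ℝ E - 1 = Module.finrank ℝ (ℝ ∙ ν)ᗮ := by omega
  rw [h2, InnerProductSpace.euclideanHausdorffMeasure_eq_volume]

end LocalTube

/-! ### The volume of thin flow tubes over small pieces of a hypersurface -/

section LocalTube

variable {E : Type*} [NormedAddCommGroup E] [InnerProductSpace ℝ E] [FiniteDimensional ℝ E]

/-- Near a point with nonzero gradient, differences of points of a level set are almost orthogonal
to the gradient. -/
theorem flat_of_level_set {S : Set E} {ρ : E → ℝ} (hρ : ContDiff ℝ 1 ρ)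
    (hS : ∀ x ∈ S, ρ x = 0) {x₀ : E} (hx₀ : gradient ρ x₀ ≠ 0) {η : ℝ} (hη : 0 < η) :
    ∃ δ > 0, ∀ z ∈ S ∩ Metric.ball x₀ δ, ∀ z' ∈ S ∩ Metric.ball x₀ δ,
      |inner ℝ (unitNormal ρ x₀) (z - z')| ≤ η * ‖z - z'‖ := by
  have hg : 0 < ‖gradient ρ x₀‖ := norm_pos_iff.2 hx₀
  have hstrict := (hρ.contDiffAt (x := x₀)).hasStrictFDerivAt (by simp)
  have hev := hstrict.isLittleO.def (mul_pos hη hg)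
  rw [nhds_prod_eq] at hev
  obtain ⟨δ, hδ, h⟩ := (Metric.nhds_basis_ball.prod_self).eventually_iff.1 hev
  refine ⟨δ, hδ, fun z hz z' hz' => ?_⟩
  have h1 := @h (z, z') ⟨hz.2, hz'.2⟩
  simp only [hS z hz.1, hS z' hz'.1, sub_self, zero_sub, norm_neg, Real.norm_eq_abs] at h1
  rw [unitNormal, real_inner_smul_left, inner_gradient_left, abs_mul, abs_inv, abs_norm,
    inv_mul_le_iff₀ hg]
  linarith

variable [MeasurableSpace E] [BorelSpace E]

/-- The tube swept out in the time interval `(0, h]` by the points of a small flat piece `A` of a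
hypersurface has volume close to `h` times the area of `A` times the normal speed. Projecting `A`
orthogonally to the tangent plane changes its area only slightly, and in the resulting coordinates
the flow is close to a linear map whose determinant is, up to sign, the normal speed. -/
theorem exists_volume_tube_near {S : Set E} {x₀ ν v₀ : E} (hν : ‖ν‖ = 1)
    (hv₀ : inner ℝ ν v₀ ≠ 0)
    (hflat : ∀ η > 0, ∃ δ > 0, ∀ z ∈ S ∩ Metric.ball x₀ δ, ∀ z' ∈ S ∩ Metric.ball x₀ δ,
      |inner ℝ ν (z - z')| ≤ η * ‖z - z'‖)
    {ψ : E → ℝ → E}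
    (hψ : ∀ η > 0, ∃ δ > 0, ∀ z ∈ Metric.ball x₀ δ, ∀ z' ∈ Metric.ball x₀ δ,
      ∀ s ∈ Icc 0 δ, ∀ s' ∈ Icc 0 δ,
      ‖ψ z s - ψ z' s' - (z - z') - (s - s') • v₀‖ ≤ η * (‖z - z'‖ + |s - s'|))
    {c : ℝ} (hc : 1 < c) :
    ∃ δ > 0, InjOn (fun q : E × ℝ => ψ q.1 q.2) ((S ∩ Metric.ball x₀ δ) ×ˢ Icc 0 δ) ∧
      ∀ A ⊆ S ∩ Metric.ball x₀ δ, ∀ h ≤ δ,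
        volume ((fun q : E × ℝ => ψ q.1 q.2) '' (A ×ˢ Ioc 0 h)) ≤
          ENNReal.ofReal c * (ENNReal.ofReal h *
            (ENNReal.ofReal |inner ℝ ν v₀| * μHE[Module.finrank ℝ E - 1] A)) ∧
        ENNReal.ofReal h * (ENNReal.ofReal |inner ℝ ν v₀| * μHE[Module.finrank ℝ E - 1] A) ≤
          ENNReal.ofReal c *
            volume ((fun q : E × ℝ => ψ q.1 q.2) '' (A ×ˢ Ioc 0 h)) := by
  set n := Module.finrank ℝ E - 1
  set w₀ : ℝ := |inner ℝ ν v₀| with hw₀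
  have hw₀pos : 0 < w₀ := abs_pos.2 hv₀
  set L := shearTo ν v₀ with hL
  have hdet : |L.det| = w₀ := by rw [hL, det_shearTo hν]
  have hdet0 : L.det ≠ 0 := by rwa [hL, det_shearTo hν]
  -- `K > 1` bounds the distortion by the projection.
  obtain ⟨K, hK1, hKc⟩ : ∃ K : ℝ, 1 < K ∧ K ^ (n + 1) < c := by
    have h1 : ∀ᶠ K : ℝ in 𝓝 1, K ^ (n + 1) < c :=
      (continuous_pow (n + 1)).continuousAt.eventually_lt continuousAt_const (by simpa using hc)
    obtain ⟨K, hK⟩ := ((h1.filter_mono nhdsWithin_le_nhds).and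
      (self_mem_nhdsWithin : Ioi (1 : ℝ) ∈ 𝓝[>] 1)).exists
    exact ⟨K, hK.2, hK.1⟩
  have hK0 : 0 < K := by linarith
  have hK_le : K ≤ c := by
    have : K ^ 1 ≤ K ^ (n + 1) := pow_le_pow_right₀ hK1.le (by omega)
    linarith
  -- `K * w₀` and `K⁻¹ * w₀` enclose the determinant, so maps close enough to `L` distort volumes by
  -- a factor between them.
  have hup := addHaar_image_le_mul_of_det_lt (μ := (volume : Measure E)) L
    (m := (K * w₀).toNNReal) (by
      rw [hdet]
      change ENNReal.ofReal _ < ENNReal.ofReal _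
      rw [ENNReal.ofReal_lt_ofReal_iff (by positivity)]
      nlinarith)
  have hlow := mul_le_addHaar_image_of_lt_det (μ := (volume : Measure E)) L
    (m := (K⁻¹ * w₀).toNNReal) (by
      rw [hdet]
      change ENNReal.ofReal _ < ENNReal.ofReal _
      rw [ENNReal.ofReal_lt_ofReal_iff hw₀pos]
      have : K⁻¹ < 1 := inv_lt_one_of_one_lt₀ hK1
      nlinarith)
  let Le := L.toContinuousLinearEquivOfDetNeZero hdet0
  have hinjev : ∀ᶠ κ : ℝ≥0 in 𝓝[>] 0,
      Subsingleton E ∨ κ < ‖(Le.symm : E →L[ℝ] E)‖₊⁻¹ := by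
    by_cases hE : Subsingleton E
    · exact Eventually.of_forall fun _ => Or.inl hE
    · have : Nontrivial E := not_subsingleton_iff_nontrivial.1 hE
      have hpos : 0 < ‖(Le.symm : E →L[ℝ] E)‖₊⁻¹ := by
        rw [inv_pos]
        exact Le.nnnorm_symm_pos
      exact ((eventually_lt_nhds hpos).filter_mono nhdsWithin_le_nhds).mono fun _ => Or.inr
  obtain ⟨κ, ⟨⟨hκup, hκlow⟩, hκinj⟩, hκ⟩ := (((hup.and hlow).and hinjev).and
    (self_mem_nhdsWithin : Ioi (0 : ℝ≥0) ∈ 𝓝[>] 0)).exists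
  have hκ : (0 : ℝ) < κ := hκ
  -- The error of the linear approximation will be `5 * η`: three times the error of the linearized
  -- flow and twice the deviation of `S` from its tangent plane.
  obtain ⟨η, hη, hη2, hηκ, hηK⟩ : ∃ η : ℝ, 0 < η ∧ η ≤ 1 / 2 ∧ 5 * η ≤ κ ∧ K * (1 - η) ≥ 1 := by
    have : 0 < 1 - K⁻¹ := by
      have : K⁻¹ < 1 := inv_lt_one_of_one_lt₀ hK1
      linarith
    refine ⟨min (1 / 2) (min ((κ : ℝ) / 5) (1 - K⁻¹)), by positivity, min_le_left _ _, ?_, ?_⟩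
    · have : min (1 / 2) (min ((κ : ℝ) / 5) (1 - K⁻¹)) ≤ κ / 5 :=
        (min_le_right _ _).trans (min_le_left _ _)
      linarith
    · have h1 : min (1 / 2) (min ((κ : ℝ) / 5) (1 - K⁻¹)) ≤ 1 - K⁻¹ :=
        (min_le_right _ _).trans (min_le_right _ _)
      calc (1 : ℝ) = K * (1 - (1 - K⁻¹)) := by field_simp; ring
        _ ≤ _ := by gcongr
  obtain ⟨δ₁, hδ₁, hflat⟩ := hflat η hη
  obtain ⟨δ₂, hδ₂, hψ⟩ := hψ η hη
  set δ := min δ₁ δ₂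
  have hδ : 0 < δ := lt_min hδ₁ hδ₂
  set U := S ∩ Metric.ball x₀ δ with hU
  have hU1 : ∀ z ∈ U, z ∈ S ∩ Metric.ball x₀ δ₁ := fun z hz =>
    ⟨hz.1, Metric.ball_subset_ball (min_le_left _ _) hz.2⟩
  have hU2 : ∀ z ∈ U, z ∈ Metric.ball x₀ δ₂ := fun z hz =>
    Metric.ball_subset_ball (min_le_right _ _) hz.2
  let P : E →L[ℝ] (ℝ ∙ ν)ᗮ := (ℝ ∙ ν)ᗮ.orthogonalProjectionOnto
  have hP : ∀ w, (P w : E) = w - inner ℝ ν w • ν :=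
    coe_orthogonalProjectionOnto_orthogonal_span hν
  have hPlip : LipschitzWith 1 P := by
    refine LipschitzWith.of_dist_le_mul fun x y => ?_
    rw [dist_eq_norm, dist_eq_norm, ← map_sub, NNReal.coe_one, one_mul]
    exact Submodule.norm_orthogonalProjectionOnto_apply_le _ _
  have hPanti0 : ∀ z ∈ U, ∀ z' ∈ U, (1 - η) * ‖z - z'‖ ≤ ‖P z - P z'‖ := by
    intro z hz z' hz'
    have h1 := hflat z (hU1 z hz) z' (hU1 z' hz')
    have h2 : z - z' = (P (z - z') : E) + inner ℝ ν (z - z') • ν := by rw [hP]; abel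
    have h3 : ‖z - z'‖ ≤ ‖P (z - z')‖ + |inner ℝ ν (z - z')| := by
      calc ‖z - z'‖ = ‖(P (z - z') : E) + inner ℝ ν (z - z') • ν‖ := by rw [← h2]
        _ ≤ ‖(P (z - z') : E)‖ + ‖inner ℝ ν (z - z') • ν‖ := norm_add_le _ _
        _ = _ := by rw [norm_smul, hν, mul_one, Real.norm_eq_abs, Submodule.coe_norm]
    rw [map_sub] at h3
    linarith
  have hPanti : ∀ z ∈ U, ∀ z' ∈ U, dist z z' ≤ K.toNNReal * dist (P z) (P z') := by
    intro z hz z' hz'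
    rw [dist_eq_norm, dist_eq_norm, Real.coe_toNNReal _ hK0.le]
    calc ‖z - z'‖ ≤ K * (1 - η) * ‖z - z'‖ := le_mul_of_one_le_left (norm_nonneg _) hηK
      _ = K * ((1 - η) * ‖z - z'‖) := by ring
      _ ≤ _ := by gcongr; exact hPanti0 z hz z' hz'
  have hPinj : InjOn P U := fun x hx y hy hxy => by
    have := hPanti x hx y hy
    rw [hxy, dist_self, mul_zero] at this
    exact dist_le_zero.1 this
  let θ := Function.invFunOn P U
  have hθ : LeftInvOn θ P U := by
    have : Nonempty E := ⟨0⟩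
    exact hPinj.leftInvOn_invFunOn
  -- The flow in the coordinates given by the tangent plane and the time.
  let G : E → E := fun w => ψ (θ (P w)) (inner ℝ ν w)
  let Q : Set E → Set ℝ → Set E := fun A I => {w | P w ∈ P '' A ∧ inner ℝ ν w ∈ I}
  have key : ∀ z ∈ U, ∀ s : ℝ, inner ℝ ν ((P z : E) + s • ν) = s ∧
      P ((P z : E) + s • ν) = P z ∧ G ((P z : E) + s • ν) = ψ z s := by
    intro z hz s
    have hw1 : inner ℝ ν ((P z : E) + s • ν) = s := by
      rw [hP, inner_add_right, inner_sub_right, inner_smul_right, inner_smul_right,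
        real_inner_self_eq_norm_sq, hν]
      ring
    have hw2 : P ((P z : E) + s • ν) = P z := by
      apply Subtype.ext
      rw [hP, hw1]
      simp
    refine ⟨hw1, hw2, ?_⟩
    simp only [G, hw1, hw2]
    rw [hθ hz]
  have hGQ : ∀ A ⊆ U, ∀ I, G '' Q A I = (fun q : E × ℝ => ψ q.1 q.2) '' (A ×ˢ I) := by
    intro A hA I
    ext x
    constructor
    · rintro ⟨w, ⟨⟨z, hz, hzw⟩, hw⟩, rfl⟩
      refine ⟨(z, inner ℝ ν w), ⟨hz, hw⟩, ?_⟩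
      simp only [G]
      rw [← hzw, hθ (hA hz)]
    · rintro ⟨⟨z, s⟩, ⟨hz, hs⟩, rfl⟩
      obtain ⟨hw1, hw2, hw3⟩ := key z (hA hz) s
      exact ⟨(P z : E) + s • ν, ⟨⟨z, hz, hw2.symm⟩, by rwa [hw1]⟩, hw3⟩
  have happrox : ∀ I ⊆ Icc 0 δ, ApproximatesLinearOn G L (Q U I) κ := by
    rintro I hI w ⟨⟨z, hz, hzw⟩, hw⟩ w' ⟨⟨z', hz', hzw'⟩, hw'⟩
    set s := inner ℝ ν w
    set s' := inner ℝ ν w'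
    have hs : s ∈ Icc 0 δ₂ := ⟨(hI hw).1, (hI hw).2.trans (min_le_right _ _)⟩
    have hs' : s' ∈ Icc 0 δ₂ := ⟨(hI hw').1, (hI hw').2.trans (min_le_right _ _)⟩
    have h1 := hψ z (hU2 z hz) z' (hU2 z' hz') s hs s' hs'
    have hG1 : G w = ψ z s := by simp only [G]; rw [← hzw, hθ hz]
    have hG2 : G w' = ψ z' s' := by simp only [G]; rw [← hzw', hθ hz']
    have hPw : (P (w - w') : E) = P (z - z') := by rw [map_sub, map_sub, hzw, hzw']
    have hLw : L (w - w') = (P (w - w') : E) + (s - s') • v₀ := by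
      rw [hL, shearTo_apply, hP, inner_sub_right, smul_sub]
      abel
    have hzz : ‖z - z'‖ ≤ 2 * ‖w - w'‖ := by
      have h2 := hPanti0 z hz z' hz'
      have h3 : ‖P z - P z'‖ ≤ ‖w - w'‖ := by
        rw [hzw, hzw', ← dist_eq_norm, ← dist_eq_norm]
        simpa using hPlip.dist_le_mul w w'
      nlinarith [norm_nonneg (z - z')]
    have hss : |s - s'| ≤ ‖w - w'‖ := by
      have := abs_real_inner_le_norm ν (w - w')
      rwa [hν, one_mul, inner_sub_right] at this
    have h4 := hflat z (hU1 z hz) z' (hU1 z' hz')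
    calc ‖G w - G w' - L (w - w')‖
        = ‖(ψ z s - ψ z' s' - (z - z') - (s - s') • v₀) + inner ℝ ν (z - z') • ν‖ := by
          rw [hG1, hG2, hLw, hPw, hP]
          congr 1
          abel
      _ ≤ η * (‖z - z'‖ + |s - s'|) + η * ‖z - z'‖ := by
          refine (norm_add_le _ _).trans (add_le_add h1 ?_)
          rwa [norm_smul, hν, mul_one, Real.norm_eq_abs]
      _ ≤ η * (2 * ‖w - w'‖ + ‖w - w'‖) + η * (2 * ‖w - w'‖) := by gcongr
      _ = 5 * η * ‖w - w'‖ := by ring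
      _ ≤ κ * ‖w - w'‖ := by gcongr
  have hvolQ : ∀ A h, volume (Q A (Ioc 0 h)) = ENNReal.ofReal h * μHE[n] (P '' A) := by
    intro A h
    rw [← volume_orthogonal_eq hν, ← volume_cylinder hν]
  refine ⟨δ, hδ, ?_, fun A hA h hh => ?_⟩
  · have hGinj : InjOn G (Q U (Icc 0 δ)) := by
      have := happrox _ subset_rfl
      rw [← L.coe_toContinuousLinearEquivOfDetNeZero hdet0] at this
      exact this.injOn hκinj
    rintro ⟨z, s⟩ ⟨hz, hs⟩ ⟨z', s'⟩ ⟨hz', hs'⟩ heq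
    obtain ⟨a1, a2, a3⟩ := key z hz s
    obtain ⟨b1, b2, b3⟩ := key z' hz' s'
    have hww := hGinj (x₁ := (P z : E) + s • ν) (x₂ := (P z' : E) + s' • ν)
      ⟨⟨z, hz, a2.symm⟩, by rwa [a1]⟩ ⟨⟨z', hz', b2.symm⟩, by rwa [b1]⟩ (by rw [a3, b3]; exact heq)
    have hs_eq : s = s' := by rw [← a1, ← b1, hww]
    have hz_eq : z = z' := hPinj hz hz' (by rw [← a2, ← b2, hww])
    rw [hs_eq, hz_eq]
  · have hAQ : ApproximatesLinearOn G L (Q A (Ioc 0 h)) κ := by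
      refine (happrox (Ioc 0 h) fun s hs => ⟨hs.1.le, hs.2.trans hh⟩).mono_set ?_
      rintro w ⟨⟨z, hz, hzw⟩, hw⟩
      exact ⟨⟨z, hA hz, hzw⟩, hw⟩
    have h1 := hκup _ _ hAQ
    have h2 := hκlow _ _ hAQ
    rw [hGQ A hA, hvolQ] at h1 h2
    have h3 : μHE[n] (P '' A) ≤ μHE[n] A := by
      simpa using euclideanHausdorffMeasure_image_le (hPlip.lipschitzOnWith (s := A)) n
    have h4 : μHE[n] A ≤ ENNReal.ofReal K ^ n * μHE[n] (P '' A) :=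
      euclideanHausdorffMeasure_le_image (fun x hx y hy => hPanti x (hA hx) y (hA hy)) n
    change _ ≤ ENNReal.ofReal (K * w₀) * _ at h1
    change ENNReal.ofReal (K⁻¹ * w₀) * _ ≤ _ at h2
    constructor
    · calc _ ≤ _ := h1
        _ ≤ ENNReal.ofReal (c * w₀) * (ENNReal.ofReal h * μHE[n] A) := by gcongr
        _ = _ := by rw [ENNReal.ofReal_mul (by linarith)]; ring
    · have hcK : w₀ * K ^ n ≤ c * (K⁻¹ * w₀) := by
        have : w₀ * K ^ n = K ^ (n + 1) * (K⁻¹ * w₀) := by field_simp; ring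
        rw [this]
        gcongr
      calc _ ≤ ENNReal.ofReal h * (ENNReal.ofReal w₀ *
              (ENNReal.ofReal K ^ n * μHE[n] (P '' A))) := by gcongr
        _ = ENNReal.ofReal (w₀ * K ^ n) * (ENNReal.ofReal h * μHE[n] (P '' A)) := by
            rw [ENNReal.ofReal_mul hw₀pos.le, ENNReal.ofReal_pow hK0.le]; ring
        _ ≤ ENNReal.ofReal (c * (K⁻¹ * w₀)) * (ENNReal.ofReal h * μHE[n] (P '' A)) := by gcongr
        _ = ENNReal.ofReal c * (ENNReal.ofReal (K⁻¹ * w₀) *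
              (ENNReal.ofReal h * μHE[n] (P '' A))) := by
            rw [ENNReal.ofReal_mul (by linarith), mul_assoc]
        _ ≤ _ := by gcongr

end LocalTube

/-! ### Thin flow tubes over a compact hypersurface -/

section Surface

variable {E : Type*} [NormedAddCommGroup E] [InnerProductSpace ℝ E] [CompleteSpace E]
  {𝒳 D S : Set E} {ρ : E → ℝ}

theorem IsCrossingSurface.eq_zero (hS : IsCrossingSurface 𝒳 D S ρ) (h𝒳 : IsOpen 𝒳) :
    ∀ x ∈ S, ρ x = 0 := by
  intro x hx
  have hD : IsOpen D := by
    rw [hS.interior_eq]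
    exact h𝒳.inter (isOpen_lt hS.contDiff.continuous continuous_const)
  have hx𝒳 := hS.boundary_subset hx
  rw [hS.boundary, hD.frontier_eq] at hx
  refine le_antisymm (not_lt.1 fun h => ?_) (not_lt.1 fun h => ?_)
  · have : x ∈ 𝒳 \ closure D := by
      rw [hS.exterior_eq]
      exact ⟨hx𝒳, h⟩
    exact this.2 hx.1
  · apply hx.2
    rw [hS.interior_eq]
    exact ⟨hx𝒳, h⟩

theorem IsCrossingSurface.isCompact [FiniteDimensional ℝ E] (hS : IsCrossingSurface 𝒳 D S ρ) :
    IsCompact S := by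
  rw [hS.boundary]
  exact Metric.isCompact_of_isClosed_isBounded isClosed_frontier
    (hS.bounded.closure.subset frontier_subset_closure)

theorem IsCrossingSurface.norm_unitNormal (hS : IsCrossingSurface 𝒳 D S ρ) {x : E} (hx : x ∈ S) :
    ‖unitNormal ρ x‖ = 1 := by
  have : ‖gradient ρ x‖ ≠ 0 := norm_ne_zero_iff.2 (hS.gradient_ne_zero x hx)
  rw [unitNormal, norm_smul, norm_inv, norm_norm, inv_mul_cancel₀ this]

theorem IsCrossingSurface.continuousOn_unitNormal (hS : IsCrossingSurface 𝒳 D S ρ) :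
    ContinuousOn (unitNormal ρ) S := by
  have hg : Continuous (gradient ρ) :=
    (InnerProductSpace.toDual ℝ E).symm.continuous.comp
      (hS.contDiff.continuous_fderiv (by simp))
  exact (hg.norm.continuousOn.inv₀ fun x hx =>
    norm_ne_zero_iff.2 (hS.gradient_ne_zero x hx)).smul hg.continuousOn

end Surface

section Tube

variable {E : Type*} [NormedAddCommGroup E] [InnerProductSpace ℝ E]

theorem continuousOn_flow {ψ : E → ℝ → E} {U : Set E} {δ η : ℝ} {v₀ : E}
    (hlin : ∀ z ∈ U, ∀ z' ∈ U, ∀ s ∈ Icc 0 δ, ∀ s' ∈ Icc 0 δ,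
      ‖ψ z s - ψ z' s' - (z - z') - (s - s') • v₀‖ ≤ η * (‖z - z'‖ + |s - s'|)) (hη : 0 ≤ η) :
    ContinuousOn (fun q : E × ℝ => ψ q.1 q.2) (U ×ˢ Icc 0 δ) := by
  have hC : 0 ≤ 2 * η + 1 + ‖v₀‖ := by positivity
  refine (LipschitzOnWith.of_dist_le_mul (K := (2 * η + 1 + ‖v₀‖).toNNReal) ?_).continuousOn
  rintro ⟨z, s⟩ ⟨hz, hs⟩ ⟨z', s'⟩ ⟨hz', hs'⟩
  have h1 := hlin z hz z' hz' s hs s' hs'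
  have h2 : ‖z - z'‖ ≤ dist (z, s) (z', s') := by
    rw [← dist_eq_norm]; exact le_max_left _ _
  have h3 : |s - s'| ≤ dist (z, s) (z', s') := by
    rw [← Real.dist_eq]; exact le_max_right _ _
  rw [Real.coe_toNNReal _ hC]
  set Δ := dist (z, s) (z', s')
  calc dist (ψ z s) (ψ z' s')
      = ‖(ψ z s - ψ z' s' - (z - z') - (s - s') • v₀) + (z - z') + (s - s') • v₀‖ := by
        rw [dist_eq_norm]; congr 1; abel
    _ ≤ η * (‖z - z'‖ + |s - s'|) + ‖z - z'‖ + |s - s'| * ‖v₀‖ := by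
        refine (norm_add₃_le).trans (add_le_add (add_le_add h1 le_rfl) ?_)
        rw [norm_smul, Real.norm_eq_abs]
    _ ≤ η * (Δ + Δ) + Δ + Δ * ‖v₀‖ := by gcongr
    _ = _ := by ring

variable [FiniteDimensional ℝ E] [MeasurableSpace E] [BorelSpace E]

/-- The surface measure on the hypersurface `S`, weighted by the speed at which the vector field `v`
crosses `S` in the normal direction. -/
noncomputable def fluxMeasure (S : Set E) (ρ : E → ℝ) (v : E → E) : Measure E :=
  (μHE[Module.finrank ℝ E - 1].restrict S).withDensity
    fun x => ENNReal.ofReal |inner ℝ (v x) (unitNormal ρ x)|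

/-- The points reached at a time in `(0, h]` by the trajectories `ψ z` that start at a point `z`
of `A`. -/
def flowTube (ψ : E → ℝ → E) (A : Set E) (h : ℝ) : Set E :=
  (fun q : E × ℝ => ψ q.1 q.2) '' (A ×ˢ Ioc 0 h)

variable {𝒳 D S : Set E} {ρ : E → ℝ} {v : E → E} {ψ : E → ℝ → E}

/-- The local comparison of tube volume and flux measure, with the normal speed allowed to vary
over the small piece of `S`. -/
theorem exists_flux_tube_near (h𝒳 : IsOpen 𝒳) (hS : IsCrossingSurface 𝒳 D S ρ)
    (hv : ContDiffOn ℝ 1 v 𝒳) (hψ₀ : ∀ z ∈ 𝒳, ψ z 0 = z)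
    (hψ : ∀ z ∈ 𝒳, ∀ t, HasDerivAt (ψ z) (v (ψ z t)) t)
    (htr : ∀ x ∈ S, inner ℝ (v x) (unitNormal ρ x) ≠ 0) {c : ℝ} (hc : 1 < c)
    {x₀ : E} (hx₀ : x₀ ∈ S) :
    ∃ δ > 0, InjOn (fun q : E × ℝ => ψ q.1 q.2) ((S ∩ Metric.ball x₀ δ) ×ˢ Icc 0 δ) ∧
      ContinuousOn (fun q : E × ℝ => ψ q.1 q.2) (Metric.ball x₀ δ ×ˢ Icc 0 δ) ∧
      ∀ A ⊆ S ∩ Metric.ball x₀ δ, MeasurableSet A → ∀ h ≤ δ,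
        volume (flowTube ψ A h) ≤
          ENNReal.ofReal c * (ENNReal.ofReal h * fluxMeasure S ρ v A) ∧
        ENNReal.ofReal h * fluxMeasure S ρ v A ≤
          ENNReal.ofReal c * volume (flowTube ψ A h) := by
  have hx𝒳 := hS.boundary_subset hx₀
  obtain ⟨b, hb1, hbc⟩ : ∃ b : ℝ, 1 < b ∧ b * b < c := by
    have h1 : ∀ᶠ b : ℝ in 𝓝 1, b * b < c :=
      (continuous_id.mul continuous_id).continuousAt.eventually_lt continuousAt_const
        (by simpa using hc)
    obtain ⟨b, hb⟩ := ((h1.filter_mono nhdsWithin_le_nhds).and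
      (self_mem_nhdsWithin : Ioi (1 : ℝ) ∈ 𝓝[>] 1)).exists
    exact ⟨b, hb.2, hb.1⟩
  have hb0 : 0 < b := by linarith
  have hlin := fun η (hη : 0 < η) => exists_flow_linearization h𝒳 hv hψ₀ hψ hx𝒳 hη
  obtain ⟨δ₁, hδ₁, hinj, hvol⟩ := exists_volume_tube_near (S := S) (ψ := ψ)
    (hS.norm_unitNormal hx₀) (v₀ := v x₀) (by rw [real_inner_comm]; exact htr x₀ hx₀)
    (fun η hη => flat_of_level_set hS.contDiff (hS.eq_zero h𝒳) (hS.gradient_ne_zero x₀ hx₀) hη)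
    (fun η hη => hlin η hη) hb1
  obtain ⟨δ₂, hδ₂, hlip⟩ := hlin 1 one_pos
  rw [real_inner_comm] at hvol
  set w : E → ℝ := fun x => |inner ℝ (v x) (unitNormal ρ x)| with hw
  have hw₀ : 0 < w x₀ := abs_pos.2 (htr x₀ hx₀)
  have hwc : ContinuousOn w S :=
    ((hv.continuousOn.mono hS.boundary_subset).inner hS.continuousOn_unitNormal).abs
  obtain ⟨δ₃, hδ₃, hw3⟩ : ∃ δ₃ > 0, ∀ x ∈ S ∩ Metric.ball x₀ δ₃, w x ≤ b * w x₀ ∧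
      w x₀ ≤ b * w x := by
    have h1 : ∀ᶠ x in 𝓝[S] x₀, w x < b * w x₀ :=
      (hwc x₀ hx₀).tendsto.eventually_lt_const (lt_mul_of_one_lt_left hw₀ hb1)
    have h2 : ∀ᶠ x in 𝓝[S] x₀, w x₀ < b * w x :=
      (continuousWithinAt_const.mul (hwc x₀ hx₀)).tendsto.eventually_const_lt
        (lt_mul_of_one_lt_left hw₀ hb1)
    obtain ⟨δ₃, hδ₃, h⟩ := Metric.mem_nhdsWithin_iff.1 (h1.and h2)
    exact ⟨δ₃, hδ₃, fun x hx => ⟨(h ⟨hx.2, hx.1⟩).1.le, (h ⟨hx.2, hx.1⟩).2.le⟩⟩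
  refine ⟨min δ₁ (min δ₂ δ₃), by positivity, ?_, ?_, fun A hA hAm h hh => ?_⟩
  · refine hinj.mono (prod_mono (inter_subset_inter_right _ (Metric.ball_subset_ball ?_))
      (Icc_subset_Icc_right ?_)) <;> exact min_le_left _ _
  · refine (continuousOn_flow hlip zero_le_one).mono (prod_mono (Metric.ball_subset_ball ?_)
      (Icc_subset_Icc_right ?_)) <;> exact (min_le_right _ _).trans (min_le_left _ _)
  · have hA1 : A ⊆ S ∩ Metric.ball x₀ δ₁ :=
      hA.trans (inter_subset_inter_right _ (Metric.ball_subset_ball (min_le_left _ _)))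
    have hA3 : A ⊆ S ∩ Metric.ball x₀ δ₃ :=
      hA.trans (inter_subset_inter_right _ (Metric.ball_subset_ball
        ((min_le_right _ _).trans (min_le_right _ _))))
    obtain ⟨h1, h2⟩ := hvol A hA1 h (hh.trans (min_le_left _ _))
    have hflux : fluxMeasure S ρ v A =
        ∫⁻ x in A, ENNReal.ofReal (w x) ∂μHE[Module.finrank ℝ E - 1] := by
      rw [fluxMeasure, withDensity_apply _ hAm, Measure.restrict_restrict hAm,
        inter_eq_left.2 (hA.trans inter_subset_left)]
    have h3 : fluxMeasure S ρ v A ≤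
        ENNReal.ofReal b * (ENNReal.ofReal (w x₀) * μHE[Module.finrank ℝ E - 1] A) := by
      rw [hflux, ← mul_assoc, ← ENNReal.ofReal_mul hb0.le, ← setLIntegral_const]
      exact setLIntegral_mono' hAm fun x hx => ENNReal.ofReal_le_ofReal (hw3 x (hA3 hx)).1
    have h4 : ENNReal.ofReal (w x₀) * μHE[Module.finrank ℝ E - 1] A ≤
        ENNReal.ofReal b * fluxMeasure S ρ v A := by
      rw [hflux, ← setLIntegral_const, ← lintegral_const_mul' _ _ ENNReal.ofReal_ne_top]
      refine setLIntegral_mono' hAm fun x hx => ?_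
      rw [← ENNReal.ofReal_mul hb0.le]
      exact ENNReal.ofReal_le_ofReal (hw3 x (hA3 hx)).2
    have hbb : ENNReal.ofReal b * ENNReal.ofReal b ≤ ENNReal.ofReal c := by
      rw [← ENNReal.ofReal_mul hb0.le]
      exact ENNReal.ofReal_le_ofReal hbc.le
    constructor
    · calc _ ≤ _ := h1
        _ ≤ ENNReal.ofReal b * (ENNReal.ofReal h *
              (ENNReal.ofReal b * fluxMeasure S ρ v A)) := by gcongr
        _ = ENNReal.ofReal b * ENNReal.ofReal b * (ENNReal.ofReal h * fluxMeasure S ρ v A) := by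
            ring
        _ ≤ _ := by gcongr
    · calc _ ≤ ENNReal.ofReal h * (ENNReal.ofReal b *
              (ENNReal.ofReal (w x₀) * μHE[Module.finrank ℝ E - 1] A)) := by gcongr
        _ = ENNReal.ofReal b * (ENNReal.ofReal h *
              (ENNReal.ofReal (w x₀) * μHE[Module.finrank ℝ E - 1] A)) := by ring
        _ ≤ ENNReal.ofReal b * (ENNReal.ofReal b * volume (flowTube ψ A h)) := by
            exact mul_le_mul_right h2 _
        _ = ENNReal.ofReal b * ENNReal.ofReal b * volume (flowTube ψ A h) := by ring
        _ ≤ _ := by gcongr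

theorem measure_le_of_finite_cover {α ι : Type*} [MeasurableSpace α] {μ₁ μ₂ : Measure α}
    {B : ι → Set α} (hB : ∀ i, MeasurableSet (B i)) (t : Finset ι)
    (h : ∀ i ∈ t, ∀ A ⊆ B i, MeasurableSet A → μ₁ A ≤ μ₂ A) :
    ∀ A ⊆ ⋃ i ∈ t, B i, MeasurableSet A → μ₁ A ≤ μ₂ A := by
  classical
  induction t using Finset.induction_on with
  | empty =>
    intro A hA _
    have : A = ∅ := by simpa using hA
    simp [this]
  | insert i t hi ih =>
    intro A hA hAm
    rw [← measure_inter_add_sdiff A (hB i), ← measure_inter_add_sdiff (μ := μ₂) A (hB i)]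
    refine add_le_add (h i (Finset.mem_insert_self i t) _ inter_subset_right (hAm.inter (hB i)))
      (ih (fun j hj => h j (Finset.mem_insert_of_mem hj)) _ ?_ (hAm.diff (hB i)))
    rintro x ⟨hx, hxi⟩
    have := hA hx
    simp only [Finset.mem_insert, iUnion_iUnion_eq_or_left, mem_union] at this
    exact this.resolve_left hxi

/-- For a uniform short time, trajectories from distinct points of `S` do not meet, and `S` is
covered by finitely many balls in which tube volume and flux measure are comparable. -/
theorem exists_flow_injOn (h𝒳 : IsOpen 𝒳) (hS : IsCrossingSurface 𝒳 D S ρ)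
    (hv : ContDiffOn ℝ 1 v 𝒳) (hψ₀ : ∀ z ∈ 𝒳, ψ z 0 = z)
    (hψ : ∀ z ∈ 𝒳, ∀ t, HasDerivAt (ψ z) (v (ψ z t)) t)
    (htr : ∀ x ∈ S, inner ℝ (v x) (unitNormal ρ x) ≠ 0) {c : ℝ} (hc : 1 < c) :
    ∃ h₀ > 0, InjOn (fun q : E × ℝ => ψ q.1 q.2) (S ×ˢ Icc 0 h₀) ∧
      ContinuousOn (fun q : E × ℝ => ψ q.1 q.2) (S ×ˢ Icc 0 h₀) ∧
      ∃ (t : Finset E) (δ : E → ℝ), S ⊆ ⋃ x ∈ t, Metric.ball x (δ x) ∧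
      ∀ x ∈ t, ∀ A ⊆ S ∩ Metric.ball x (δ x), MeasurableSet A → ∀ h ≤ h₀,
        volume (flowTube ψ A h) ≤
          ENNReal.ofReal c * (ENNReal.ofReal h * fluxMeasure S ρ v A) ∧
        ENNReal.ofReal h * fluxMeasure S ρ v A ≤
          ENNReal.ofReal c * volume (flowTube ψ A h) := by
  have hSc := hS.isCompact
  -- Local comparisons hold on finitely many balls covering `S`, with Lebesgue number `ε`.
  have hloc := fun x₀ (hx₀ : x₀ ∈ S) => exists_flux_tube_near h𝒳 hS hv hψ₀ hψ htr hc hx₀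
  choose! δ hδ hinj hcont hvol using hloc
  obtain ⟨t, htS, hcover⟩ := hSc.elim_nhds_subcover (fun x => Metric.ball x (δ x))
    fun x hx => Metric.ball_mem_nhds x (hδ x hx)
  obtain ⟨ε, hε, hleb⟩ := lebesgue_number_lemma_of_metric hSc
    (c := fun x : t => Metric.ball (x : E) (δ x)) (fun _ => Metric.isOpen_ball) (by
      refine hcover.trans ?_
      simp only [iUnion_subset_iff]
      exact fun x hx => subset_iUnion (fun x : t => Metric.ball (x : E) (δ x)) ⟨x, hx⟩)
  obtain ⟨h₁, hh₁, hh₁δ⟩ : ∃ h₁ > 0, ∀ x ∈ t, h₁ ≤ δ x := by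
    have : ∀ᶠ h in 𝓝[>] (0 : ℝ), ∀ x ∈ t, h ≤ δ x :=
      (Finset.eventually_all t).2 fun x hx =>
        ((eventually_le_nhds (hδ x (htS x hx))).filter_mono nhdsWithin_le_nhds)
    obtain ⟨h, hh, hh'⟩ := (this.and self_mem_nhdsWithin).exists
    exact ⟨h, hh', hh⟩
  have hcontS : ContinuousOn (fun q : E × ℝ => ψ q.1 q.2) (S ×ˢ Icc 0 h₁) := by
    rintro ⟨z, s⟩ ⟨hz, hs⟩
    obtain ⟨x, hx⟩ := hleb z hz
    have hzx := hx (Metric.mem_ball_self hε)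
    have hxδ := hh₁δ x x.2
    refine (hcont x (htS x x.2) (z, s) ⟨hzx, hs.1, hs.2.trans hxδ⟩).mono_of_mem_nhdsWithin ?_
    rw [nhdsWithin_prod_eq]
    refine prod_mem_prod (mem_nhdsWithin_of_mem_nhds (Metric.isOpen_ball.mem_nhds hzx)) ?_
    exact mem_of_superset self_mem_nhdsWithin (Icc_subset_Icc_right hxδ)
  -- Trajectories through distinct points of `S` can only meet if these points are close.
  have hunif := (hSc.prod isCompact_Icc).uniformContinuousOn_of_continuous hcontS
  obtain ⟨h₂, hh₂, hclose⟩ := Metric.uniformContinuousOn_iff.1 hunif (ε / 2) (by positivity)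
  set h₀ := min h₁ (h₂ / 2)
  have hh₀ : 0 < h₀ := by positivity
  have hh₀₁ : h₀ ≤ h₁ := min_le_left _ _
  have hnear : ∀ z ∈ S, ∀ s ∈ Icc 0 h₀, dist (ψ z s) z < ε / 2 := by
    intro z hz s hs
    have := hclose (z, s) ⟨hz, hs.1, hs.2.trans hh₀₁⟩ (z, 0) ⟨hz, le_rfl, hh₁.le⟩ (by
      rw [Prod.dist_eq]
      simp only [dist_self, Real.dist_eq, sub_zero, abs_of_nonneg hs.1]
      rw [max_eq_right hs.1]
      have := hs.2.trans (min_le_right h₁ (h₂ / 2))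
      linarith)
    simpa [hψ₀ z (hS.boundary_subset hz)] using this
  refine ⟨h₀, hh₀, ?_, hcontS.mono (prod_mono_right (Icc_subset_Icc_right hh₀₁)), t, δ, hcover,
    fun x hx A hA hAm h hh => hvol x (htS x hx) A hA hAm h (hh.trans (hh₀₁.trans (hh₁δ x hx)))⟩
  rintro ⟨z, s⟩ ⟨hz, hs⟩ ⟨z', s'⟩ ⟨hz', hs'⟩ heq
  simp only at hz hs hz' hs' heq
  obtain ⟨x, hx⟩ := hleb z hz
  have hzz : z' ∈ Metric.ball z ε := by
    have h1 := hnear z hz s hs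
    have h2 := hnear z' hz' s' hs'
    rw [heq] at h1
    rw [Metric.mem_ball]
    have := dist_triangle_left z' z (ψ z' s')
    linarith
  have hsδ : ∀ s ∈ Icc 0 h₀, s ∈ Icc 0 (δ x) := fun s hs =>
    ⟨hs.1, hs.2.trans (hh₀₁.trans (hh₁δ x x.2))⟩
  exact hinj x (htS x x.2) ⟨⟨hz, hx (Metric.mem_ball_self hε)⟩, hsδ s hs⟩
    ⟨⟨hz', hx hzz⟩, hsδ s' hs'⟩ heq

/-- Integrals over thin tubes compared with flux integrals: if `f` is bounded above (below) along
the trajectory from `z` by `g z`, then so is its integral over the tube by `h` times the flux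
integral of `g`, up to a factor `c` that is arbitrarily close to `1` for small `h`. -/
theorem exists_lintegral_flowTube_bounds (h𝒳 : IsOpen 𝒳) (hS : IsCrossingSurface 𝒳 D S ρ)
    (hv : ContDiffOn ℝ 1 v 𝒳) (hψ₀ : ∀ z ∈ 𝒳, ψ z 0 = z)
    (hψ : ∀ z ∈ 𝒳, ∀ t, HasDerivAt (ψ z) (v (ψ z t)) t)
    (htr : ∀ x ∈ S, inner ℝ (v x) (unitNormal ρ x) ≠ 0) {c : ℝ} (hc : 1 < c) :
    ∃ h₀ > 0, ContinuousOn (fun q : E × ℝ => ψ q.1 q.2) (S ×ˢ Icc 0 h₀) ∧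
      ∀ h ≤ h₀, MeasurableSet (flowTube ψ S h) ∧ ∀ f g : E → ℝ≥0∞, Measurable g →
        ((∀ z ∈ S, ∀ u ∈ Ioc 0 h, f (ψ z u) ≤ g z) →
          ∫⁻ x in flowTube ψ S h, f x ≤
            ENNReal.ofReal c * (ENNReal.ofReal h * ∫⁻ z, g z ∂fluxMeasure S ρ v)) ∧
        ((∀ z ∈ S, ∀ u ∈ Ioc 0 h, g z ≤ f (ψ z u)) →
          ENNReal.ofReal h * ∫⁻ z, g z ∂fluxMeasure S ρ v ≤
            ENNReal.ofReal c * ∫⁻ x in flowTube ψ S h, f x) := by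
  obtain ⟨h₀, hh₀, hinj, hcont, t, δ, hcover, hvol⟩ :=
    exists_flow_injOn h𝒳 hS hv hψ₀ hψ htr hc
  refine ⟨h₀, hh₀, hcont, fun h hh => ?_⟩
  have hSm : MeasurableSet S := hS.isCompact.isClosed.measurableSet
  have hsub : S ×ˢ Ioc 0 h ⊆ S ×ˢ Icc 0 h₀ :=
    prod_mono_right (Ioc_subset_Icc_self.trans (Icc_subset_Icc_right hh))
  have hemb := (hcont.mono hsub).measurableEmbedding (hSm.prod measurableSet_Ioc)
    (hinj.mono hsub)
  have hrange : range ((S ×ˢ Ioc 0 h).domRestrict fun q : E × ℝ => ψ q.1 q.2) =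
      flowTube ψ S h := range_domRestrict _ _
  set Ψ := (S ×ˢ Ioc 0 h).domRestrict fun q : E × ℝ => ψ q.1 q.2 with hΨ
  have hmeas : MeasurableSet (flowTube ψ S h) := hrange ▸ hemb.measurableSet_range
  refine ⟨hmeas, fun f g hg => ?_⟩
  -- The volume of the tube, as a measure on the points of `S` that its points come from.
  let base : ↥(S ×ˢ Ioc (0 : ℝ) h) → E := fun q => q.1.1
  have hbase : Measurable base := measurable_fst.comp measurable_subtype_coe
  set τ := (volume : Measure E).comap Ψ
  set κ := τ.map base
  have hκ : ∀ A, MeasurableSet A → κ A = volume (flowTube ψ (A ∩ S) h) := by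
    intro A hA
    rw [Measure.map_apply hbase hA, hemb.comap_apply]
    congr 1
    ext x
    simp only [flowTube, mem_image, mem_preimage]
    constructor
    · rintro ⟨⟨⟨z, s⟩, hz, hs⟩, hzA, rfl⟩
      exact ⟨(z, s), ⟨⟨hzA, hz⟩, hs⟩, rfl⟩
    · rintro ⟨⟨z, s⟩, ⟨⟨hzA, hz⟩, hs⟩, rfl⟩
      exact ⟨⟨(z, s), hz, hs⟩, hzA, rfl⟩
  have hflux : ∀ A, MeasurableSet A → fluxMeasure S ρ v (A ∩ S) = fluxMeasure S ρ v A := by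
    intro A hA
    rw [fluxMeasure, withDensity_apply _ (hA.inter hSm), withDensity_apply _ hA,
      Measure.restrict_restrict (hA.inter hSm), Measure.restrict_restrict hA, inter_assoc,
      inter_self]
  have hκS : ∀ A, MeasurableSet A → κ (A ∩ S) = κ A := by
    intro A hA
    rw [hκ A hA, hκ _ (hA.inter hSm), inter_assoc, inter_self]
  have hball : ∀ x, MeasurableSet (S ∩ Metric.ball x (δ x)) := fun x =>
    hSm.inter measurableSet_ball
  have hcover' : ∀ A, A ∩ S ⊆ ⋃ x ∈ t, S ∩ Metric.ball x (δ x) := by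
    rintro A x ⟨-, hx⟩
    have := hcover hx
    simp only [mem_iUnion, exists_prop] at this ⊢
    obtain ⟨i, hi, hxi⟩ := this
    exact ⟨i, hi, hx, hxi⟩
  have hκle : κ ≤ (ENNReal.ofReal c * ENNReal.ofReal h) • fluxMeasure S ρ v := by
    refine Measure.le_iff.2 fun A hA => ?_
    rw [← hκS A hA, Measure.smul_apply, ← hflux A hA, ← Measure.smul_apply]
    refine measure_le_of_finite_cover hball t (fun x hx B hB hBm => ?_) _ (hcover' A)
      (hA.inter hSm)
    rw [hκ B hBm, inter_eq_left.2 (hB.trans inter_subset_left), Measure.smul_apply, smul_eq_mul,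
      mul_assoc]
    exact (hvol x hx B hB hBm h hh).1
  have hleκ : ENNReal.ofReal h • fluxMeasure S ρ v ≤ ENNReal.ofReal c • κ := by
    refine Measure.le_iff.2 fun A hA => ?_
    rw [Measure.smul_apply, Measure.smul_apply, ← hκS A hA, ← hflux A hA, ← Measure.smul_apply,
      ← Measure.smul_apply]
    refine measure_le_of_finite_cover hball t (fun x hx B hB hBm => ?_) _ (hcover' A)
      (hA.inter hSm)
    rw [Measure.smul_apply, Measure.smul_apply, hκ B hBm,
      inter_eq_left.2 (hB.trans inter_subset_left), smul_eq_mul, smul_eq_mul]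
    exact (hvol x hx B hB hBm h hh).2
  have hf : ∫⁻ x in flowTube ψ S h, f x = ∫⁻ q, f (Ψ q) ∂τ := by
    rw [← hrange, ← hemb.map_comap, hemb.lintegral_map]
  have hgκ : ∫⁻ z, g z ∂κ = ∫⁻ q, g (base q) ∂τ := lintegral_map hg hbase
  constructor
  · intro hfg
    calc _ = ∫⁻ q, f (Ψ q) ∂τ := hf
      _ ≤ ∫⁻ q, g (base q) ∂τ := lintegral_mono fun q => hfg _ q.2.1 _ q.2.2
      _ = ∫⁻ z, g z ∂κ := hgκ.symm
      _ ≤ ∫⁻ z, g z ∂((ENNReal.ofReal c * ENNReal.ofReal h) • fluxMeasure S ρ v) :=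
          lintegral_mono' hκle le_rfl
      _ = _ := by rw [lintegral_smul_measure, smul_eq_mul, mul_assoc]
  · intro hfg
    calc _ = ∫⁻ z, g z ∂(ENNReal.ofReal h • fluxMeasure S ρ v) := by
          rw [lintegral_smul_measure, smul_eq_mul]
      _ ≤ ∫⁻ z, g z ∂(ENNReal.ofReal c • κ) := lintegral_mono' hleκ le_rfl
      _ = ENNReal.ofReal c * ∫⁻ q, g (base q) ∂τ := by
          rw [lintegral_smul_measure, smul_eq_mul, hgκ]
      _ ≤ ENNReal.ofReal c * ∫⁻ q, f (Ψ q) ∂τ := by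
          gcongr with q
          exact hfg _ q.2.1 _ q.2.2
      _ = _ := by rw [hf]

end Tube

/-! ### Sums over a time grid -/

section Asymptotics

theorem lintegral_Icc_eq_sum_grid (f : ℝ → ℝ≥0∞) {h : ℝ} (hh : 0 ≤ h) (N : ℕ) :
    ∫⁻ s in Icc 0 (N * h), f s =
      ∑ k ∈ Finset.range N, ∫⁻ s in Ioc (k * h) ((k + 1 : ℕ) * h), f s := by
  rw [← setLIntegral_congr Ioc_ae_eq_Icc]
  induction N with
  | zero => simp
  | succ N ih =>
    rw [Finset.sum_range_succ, ← ih, ← lintegral_union measurableSet_Ioc,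
      Ioc_union_Ioc_eq_Ioc (by positivity) (by push_cast; nlinarith)]
    exact Set.disjoint_left.2 fun x hx hx' => not_lt.2 hx.2 hx'.1

variable {E : Type*} [NormedAddCommGroup E] [InnerProductSpace ℝ E] [FiniteDimensional ℝ E]
  [MeasurableSpace E] [BorelSpace E]
  {𝒳 D S : Set E} {ρ : E → ℝ} {v : E → E} {ψ : E → ℝ → E}

/-- The flux measure is finite because it is dominated by the volume of a bounded tube. -/
theorem fluxMeasure_univ_lt_top (h𝒳 : IsOpen 𝒳) (hS : IsCrossingSurface 𝒳 D S ρ)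
    (hv : ContDiffOn ℝ 1 v 𝒳) (hψ₀ : ∀ z ∈ 𝒳, ψ z 0 = z)
    (hψ : ∀ z ∈ 𝒳, ∀ t, HasDerivAt (ψ z) (v (ψ z t)) t)
    (htr : ∀ x ∈ S, inner ℝ (v x) (unitNormal ρ x) ≠ 0) :
    fluxMeasure S ρ v univ < ∞ := by
  obtain ⟨h₀, hh₀, hcont, hb⟩ :=
    exists_lintegral_flowTube_bounds h𝒳 hS hv hψ₀ hψ htr one_lt_two
  obtain ⟨-, hb⟩ := hb h₀ le_rfl
  have h1 := (hb (fun _ => 1) (fun _ => 1) measurable_const).2 fun _ _ _ _ => le_rfl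
  simp only [lintegral_one, Measure.restrict_apply_univ] at h1
  have h2 : volume (flowTube ψ S h₀) < ∞ := by
    refine lt_of_le_of_lt (measure_mono (image_mono (prod_mono_right Ioc_subset_Icc_self)))
      ((hS.isCompact.prod isCompact_Icc).image_of_continuousOn hcont).measure_lt_top
  have h3 : ENNReal.ofReal h₀ * fluxMeasure S ρ v univ < ∞ :=
    h1.trans_lt (ENNReal.mul_lt_top ENNReal.ofReal_lt_top h2)
  refine lt_top_iff_ne_top.2 fun htop => ?_
  rw [htop, ENNReal.mul_top (by simpa using hh₀)] at h3
  exact lt_irrefl _ h3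

/-- Up to a factor `c` close to `1` and an additive error proportional to `c - 1`, the sum of the
integrals of the densities over the tubes belonging to the time steps of a fine grid agrees with the
flux integral. -/
theorem eventually_sum_flowTube_bounds (h𝒳 : IsOpen 𝒳) (hS : IsCrossingSurface 𝒳 D S ρ)
    (hv : ContDiffOn ℝ 1 v 𝒳) (hψ₀ : ∀ z ∈ 𝒳, ψ z 0 = z)
    (hψ : ∀ z ∈ 𝒳, ∀ t, HasDerivAt (ψ z) (v (ψ z t)) t)
    (htr : ∀ x ∈ S, inner ℝ (v x) (unitNormal ρ x) ≠ 0)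
    {H : ℝ} (hH : 0 < H) {V : Set E} (hV : IsOpen V) (hSV : S ⊆ V) {p : ℝ → E → ℝ≥0}
    (hpm : ∀ t ∈ Icc 0 H, Measurable (p t))
    (hpc : ContinuousOn (fun q : E × ℝ => p q.2 q.1) (V ×ˢ Icc 0 H)) {c : ℝ} (hc : 1 < c) :
    ∀ᶠ N : ℕ in atTop,
      ∑ k ∈ Finset.range N, ∫⁻ x in flowTube ψ S (H / N), (p (k * (H / N)) x : ℝ≥0∞) ≤
        ENNReal.ofReal c * ((∫⁻ s in Icc 0 H, ∫⁻ z, (p s z : ℝ≥0∞) ∂fluxMeasure S ρ v) +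
          ENNReal.ofReal (c - 1) * (ENNReal.ofReal H * fluxMeasure S ρ v univ)) ∧
      ∫⁻ s in Icc 0 H, ∫⁻ z, (p s z : ℝ≥0∞) ∂fluxMeasure S ρ v ≤
        ENNReal.ofReal c *
          ((∑ k ∈ Finset.range N,
            ∫⁻ x in flowTube ψ S (H / N), (p (k * (H / N)) x : ℝ≥0∞)) +
          ENNReal.ofReal (c - 1) *
            (ENNReal.ofReal c * (ENNReal.ofReal H * fluxMeasure S ρ v univ))) := by
  set Λ := fluxMeasure S ρ v with hΛ
  set ε := ENNReal.ofReal (c - 1)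
  obtain ⟨h₀, hh₀, hcont, hb⟩ :=
    exists_lintegral_flowTube_bounds h𝒳 hS hv hψ₀ hψ htr hc
  have hSc := hS.isCompact
  have hψS : ∀ z ∈ S, ψ z 0 = z := fun z hz => hψ₀ z (hS.boundary_subset hz)
  -- For short times, the tube stays in `V`.
  obtain ⟨h₁, hh₁, hh₁₀, hh₁V⟩ : ∃ h₁ > 0, h₁ ≤ h₀ ∧ ∀ z ∈ S, ∀ u ∈ Icc 0 h₁, ψ z u ∈ V := by
    obtain ⟨ε', hε', hthick⟩ := hSc.exists_thickening_subset_open hV hSV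
    have hunif := (hSc.prod isCompact_Icc).uniformContinuousOn_of_continuous hcont
    obtain ⟨h₂, hh₂, hclose⟩ := Metric.uniformContinuousOn_iff.1 hunif ε' hε'
    refine ⟨min h₀ (h₂ / 2), by positivity, min_le_left _ _, fun z hz u hu => ?_⟩
    have := hclose (z, u) ⟨hz, hu.1, hu.2.trans (min_le_left _ _)⟩ (z, 0) ⟨hz, le_rfl, hh₀.le⟩ (by
      rw [Prod.dist_eq]
      simp only [dist_self, Real.dist_eq, sub_zero, abs_of_nonneg hu.1]
      rw [max_eq_right hu.1]
      have := hu.2.trans (min_le_right h₀ (h₂ / 2))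
      linarith)
    simp only [hψS z hz] at this
    exact hthick (Metric.mem_thickening_iff.2 ⟨z, hz, this⟩)
  -- The density is almost constant along the trajectories through the tube.
  obtain ⟨h₂, hh₂, hh₂₁, hclose⟩ : ∃ h₂ > 0, h₂ ≤ h₁ ∧ ∀ z ∈ S, ∀ u ∈ Icc 0 h₂,
      ∀ t ∈ Icc 0 H, ∀ s ∈ Icc 0 H, |t - s| ≤ h₂ → dist (p t (ψ z u)) (p s z) < c - 1 := by
    have hF : ContinuousOn (fun q : (E × ℝ) × ℝ => p q.2 (ψ q.1.1 q.1.2))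
        ((S ×ˢ Icc 0 h₁) ×ˢ Icc 0 H) := by
      refine hpc.comp (f := fun q : (E × ℝ) × ℝ => (ψ q.1.1 q.1.2, q.2)) ?_ ?_
      · exact ((hcont.mono (prod_mono_right (Icc_subset_Icc_right hh₁₀))).comp continuousOn_fst
          fun q hq => hq.1).prodMk continuousOn_snd
      · exact fun q hq => ⟨hh₁V _ hq.1.1 _ hq.1.2, hq.2⟩
    have hunif := ((hSc.prod isCompact_Icc).prod isCompact_Icc).uniformContinuousOn_of_continuous hF
    obtain ⟨h₃, hh₃, hclose⟩ := Metric.uniformContinuousOn_iff.1 hunif (c - 1) (by linarith)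
    refine ⟨min h₁ (h₃ / 2), by positivity, min_le_left _ _, fun z hz u hu t ht s hs hts => ?_⟩
    have := hclose ((z, u), t) ⟨⟨hz, hu.1, hu.2.trans (min_le_left _ _)⟩, ht⟩ ((z, 0), s)
      ⟨⟨hz, le_rfl, hh₁.le⟩, hs⟩ (by
        have h1 := hu.2.trans (min_le_right h₁ (h₃ / 2))
        have h2 := hts.trans (min_le_right h₁ (h₃ / 2))
        simp only [Prod.dist_eq, dist_self, Real.dist_eq, sub_zero, abs_of_nonneg hu.1]
        rw [max_eq_right hu.1]
        exact max_lt (by linarith) (by linarith))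
    simpa only [hψS z hz] using this
  have hN : ∀ᶠ N : ℕ in atTop, 0 < N ∧ H / N ≤ h₂ := by
    have h1 := (tendsto_const_div_atTop_nhds_zero_nat H).eventually (eventually_le_nhds hh₂)
    exact (eventually_gt_atTop 0).and h1
  filter_upwards [hN] with N hN
  obtain ⟨hN0, hhh⟩ := hN
  set h := H / N with hh
  have hN0' : (0 : ℝ) < N := by exact_mod_cast hN0
  have hhpos : 0 < h := by positivity
  have hNh : N * h = H := by rw [hh]; field_simp
  have hofh : ENNReal.ofReal h ≠ 0 := by simpa using hhpos
  obtain ⟨hTm, hb⟩ := hb h (hhh.trans (hh₂₁.trans hh₁₀))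
  have hNH : (N : ℝ≥0∞) * ENNReal.ofReal h = ENNReal.ofReal H := by
    rw [← hNh, ENNReal.ofReal_mul hN0'.le, ENNReal.ofReal_natCast]
  have hTvol : volume (flowTube ψ S h) ≤ ENNReal.ofReal c * (ENNReal.ofReal h * Λ univ) := by
    have := (hb (fun _ => 1) (fun _ => 1) measurable_const).1 fun _ _ _ _ => le_rfl
    simpa using this
  have hgrid : ∀ k ∈ Finset.range N, ∀ s ∈ Ioc (k * h) ((k + 1 : ℕ) * h),
      s ∈ Icc 0 H ∧ (k * h) ∈ Icc 0 H ∧ |k * h - s| ≤ h₂ := by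
    intro k hk s hs
    have hkN : ((k + 1 : ℕ) : ℝ) ≤ N := by exact_mod_cast Finset.mem_range.1 hk
    have h1 : ((k + 1 : ℕ) : ℝ) * h ≤ H := by rw [← hNh]; gcongr
    have h0 : 0 ≤ k * h := by positivity
    refine ⟨⟨h0.trans hs.1.le, hs.2.trans h1⟩, ⟨h0, ?_⟩, ?_⟩
    · exact hs.1.le.trans (hs.2.trans h1)
    · have h2 := hs.2
      push_cast at h2
      rw [abs_sub_comm, abs_of_nonneg (by linarith [hs.1])]
      linarith
  have hvolI : ∀ k : ℕ, volume (Ioc (k * h) ((k + 1 : ℕ) * h)) = ENNReal.ofReal h := by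
    intro k
    rw [Real.volume_Ioc]
    congr 1
    push_cast
    ring
  have hdist : ∀ a b : ℝ≥0, dist a b < c - 1 → (a : ℝ≥0∞) ≤ b + ε := by
    intro a b hab
    rw [NNReal.dist_eq, abs_lt] at hab
    rw [← ENNReal.ofReal_coe_nnreal (p := a), ← ENNReal.ofReal_coe_nnreal (p := b)]
    simp only [ε]
    rw [← ENNReal.ofReal_add b.coe_nonneg (by linarith [hab.1, hab.2])]
    exact ENNReal.ofReal_le_ofReal (by linarith)
  have hIcc : Icc (0 : ℝ) H = Icc 0 (N * h) := by rw [hNh]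
  set a : ℕ → ℝ≥0∞ := fun k => ∫⁻ x in flowTube ψ S h, (p (k * h) x : ℝ≥0∞) with ha
  set J : ℕ → ℝ≥0∞ := fun k => ∫⁻ s in Ioc (k * h) ((k + 1 : ℕ) * h),
    ∫⁻ z, (p s z : ℝ≥0∞) ∂Λ with hJ
  have hsumconst : ∀ b : ℝ≥0∞, ∑ _k ∈ Finset.range N, ENNReal.ofReal h * b =
      ENNReal.ofReal H * b := by
    intro b
    rw [Finset.sum_const, Finset.card_range, nsmul_eq_mul, ← mul_assoc, hNH]
  -- Both bounds hold for every time of the step; integrating over the step gives the comparison.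
  have hup : ∀ k ∈ Finset.range N, a k ≤
      ENNReal.ofReal c * (J k + ENNReal.ofReal h * (ε * Λ univ)) := by
    intro k hk
    have hs : ∀ s ∈ Ioc (k * h) ((k + 1 : ℕ) * h), a k ≤ ENNReal.ofReal c * (ENNReal.ofReal h *
        ((∫⁻ z, (p s z : ℝ≥0∞) ∂Λ) + ε * Λ univ)) := by
      intro s hs
      obtain ⟨hsH, hkH, hks⟩ := hgrid k hk s hs
      have := (hb (fun x => p (k * h) x) (fun z => p s z + ε)
        ((hpm s hsH).coe_nnreal_ennreal.add_const ε)).1 fun z hz u hu =>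
          hdist _ _ (hclose z hz u ⟨hu.1.le, hu.2.trans hhh⟩ _ hkH s hsH hks)
      rwa [lintegral_add_right _ measurable_const, lintegral_const] at this
    have hint : ENNReal.ofReal h * a k ≤ ENNReal.ofReal h *
        (ENNReal.ofReal c * (J k + ENNReal.ofReal h * (ε * Λ univ))) := by
      calc ENNReal.ofReal h * a k = ∫⁻ _s in Ioc (k * h) ((k + 1 : ℕ) * h), a k := by
            rw [setLIntegral_const, hvolI, mul_comm]
        _ ≤ ∫⁻ s in Ioc (k * h) ((k + 1 : ℕ) * h), ENNReal.ofReal c * (ENNReal.ofReal h *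
              ((∫⁻ z, (p s z : ℝ≥0∞) ∂Λ) + ε * Λ univ)) :=
            setLIntegral_mono' measurableSet_Ioc hs
        _ = ENNReal.ofReal c * (ENNReal.ofReal h *
              (J k + ENNReal.ofReal h * (ε * Λ univ))) := by
            rw [lintegral_const_mul' _ _ ENNReal.ofReal_ne_top,
              lintegral_const_mul' _ _ ENNReal.ofReal_ne_top,
              lintegral_add_right _ measurable_const, setLIntegral_const, hvolI,
              mul_comm (ENNReal.ofReal h) (ε * Λ univ)]
        _ = _ := by ring
    exact (ENNReal.mul_le_mul_iff_right hofh ENNReal.ofReal_ne_top).1 hint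
  have hlow : ∀ k ∈ Finset.range N, J k ≤ ENNReal.ofReal c *
      (a k + ENNReal.ofReal h * (ε * (ENNReal.ofReal c * Λ univ))) := by
    intro k hk
    have hs : ∀ s ∈ Ioc (k * h) ((k + 1 : ℕ) * h), ENNReal.ofReal h * ∫⁻ z, (p s z : ℝ≥0∞) ∂Λ ≤
        ENNReal.ofReal c *
          (a k + ENNReal.ofReal h * (ε * (ENNReal.ofReal c * Λ univ))) := by
      intro s hs
      obtain ⟨hsH, hkH, hks⟩ := hgrid k hk s hs
      have := (hb (fun x => p (k * h) x + ε) (fun z => p s z)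
        (hpm s hsH).coe_nnreal_ennreal).2 fun z hz u hu =>
          hdist _ _ (by
            rw [dist_comm]
            exact hclose z hz u ⟨hu.1.le, hu.2.trans hhh⟩ _ hkH s hsH hks)
      rw [lintegral_add_right _ measurable_const, setLIntegral_const] at this
      refine this.trans ?_
      refine mul_le_mul_right (add_le_add_right ?_ _) _
      calc ε * volume (flowTube ψ S h) ≤
            ε * (ENNReal.ofReal c * (ENNReal.ofReal h * Λ univ)) := by gcongr
        _ = _ := by ring
    have hint : ENNReal.ofReal h * J k ≤ ENNReal.ofReal h * (ENNReal.ofReal c *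
        (a k + ENNReal.ofReal h * (ε * (ENNReal.ofReal c * Λ univ)))) := by
      calc ENNReal.ofReal h * J k = ∫⁻ s in Ioc (k * h) ((k + 1 : ℕ) * h),
            ENNReal.ofReal h * ∫⁻ z, (p s z : ℝ≥0∞) ∂Λ := by
            rw [lintegral_const_mul' _ _ ENNReal.ofReal_ne_top]
        _ ≤ ∫⁻ _s in Ioc (k * h) ((k + 1 : ℕ) * h), ENNReal.ofReal c *
              (a k + ENNReal.ofReal h * (ε * (ENNReal.ofReal c * Λ univ))) :=
            setLIntegral_mono' measurableSet_Ioc hs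
        _ = _ := by rw [setLIntegral_const, hvolI, mul_comm]
    exact (ENNReal.mul_le_mul_iff_right hofh ENNReal.ofReal_ne_top).1 hint
  rw [hIcc, lintegral_Icc_eq_sum_grid _ hhpos.le]
  constructor
  · calc ∑ k ∈ Finset.range N, a k ≤ ∑ k ∈ Finset.range N,
          ENNReal.ofReal c * (J k + ENNReal.ofReal h * (ε * Λ univ)) := Finset.sum_le_sum hup
      _ = ENNReal.ofReal c * ((∑ k ∈ Finset.range N, J k) + ENNReal.ofReal H * (ε * Λ univ)) := by
          rw [← Finset.mul_sum, Finset.sum_add_distrib, hsumconst]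
      _ = _ := by rw [mul_left_comm (ENNReal.ofReal H)]
  · calc ∑ k ∈ Finset.range N, J k ≤ ∑ k ∈ Finset.range N, ENNReal.ofReal c *
          (a k + ENNReal.ofReal h * (ε * (ENNReal.ofReal c * Λ univ))) := Finset.sum_le_sum hlow
      _ = ENNReal.ofReal c * ((∑ k ∈ Finset.range N, a k) +
            ENNReal.ofReal H * (ε * (ENNReal.ofReal c * Λ univ))) := by
          rw [← Finset.mul_sum, Finset.sum_add_distrib, hsumconst]
      _ = _ := by
          rw [mul_left_comm (ENNReal.ofReal H), mul_left_comm (ENNReal.ofReal H)]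

theorem lintegral_flux_lt_top (h𝒳 : IsOpen 𝒳) (hS : IsCrossingSurface 𝒳 D S ρ)
    (hv : ContDiffOn ℝ 1 v 𝒳) (hψ₀ : ∀ z ∈ 𝒳, ψ z 0 = z)
    (hψ : ∀ z ∈ 𝒳, ∀ t, HasDerivAt (ψ z) (v (ψ z t)) t)
    (htr : ∀ x ∈ S, inner ℝ (v x) (unitNormal ρ x) ≠ 0)
    {H : ℝ} {V : Set E} (hSV : S ⊆ V) {p : ℝ → E → ℝ≥0}
    (hpc : ContinuousOn (fun q : E × ℝ => p q.2 q.1) (V ×ˢ Icc 0 H)) :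
    ∫⁻ s in Icc 0 H, ∫⁻ z, (p s z : ℝ≥0∞) ∂fluxMeasure S ρ v < ∞ := by
  obtain ⟨B, hB⟩ := ((hS.isCompact.prod isCompact_Icc).image_of_continuousOn
    (hpc.mono (prod_mono_left hSV))).bddAbove
  have hSm : MeasurableSet S := hS.isCompact.isClosed.measurableSet
  have hae : ∀ᵐ z ∂fluxMeasure S ρ v, z ∈ S :=
    (withDensity_absolutelyContinuous _ _).ae_le (ae_restrict_mem hSm)
  calc _ ≤ ∫⁻ _s in Icc 0 H, B * fluxMeasure S ρ v univ := by
        refine setLIntegral_mono' measurableSet_Icc fun s hs => ?_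
        rw [← lintegral_const]
        refine lintegral_mono_ae (hae.mono fun z hz => ?_)
        exact_mod_cast hB ⟨(z, s), ⟨hz, hs⟩, rfl⟩
    _ = B * fluxMeasure S ρ v univ * volume (Icc 0 H) := setLIntegral_const _ _
    _ < ∞ := ENNReal.mul_lt_top (ENNReal.mul_lt_top ENNReal.coe_lt_top
        (fluxMeasure_univ_lt_top h𝒳 hS hv hψ₀ hψ htr)) (by simp)

theorem tendsto_sum_flowTube (h𝒳 : IsOpen 𝒳) (hS : IsCrossingSurface 𝒳 D S ρ)
    (hv : ContDiffOn ℝ 1 v 𝒳) (hψ₀ : ∀ z ∈ 𝒳, ψ z 0 = z)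
    (hψ : ∀ z ∈ 𝒳, ∀ t, HasDerivAt (ψ z) (v (ψ z t)) t)
    (htr : ∀ x ∈ S, inner ℝ (v x) (unitNormal ρ x) ≠ 0)
    {H : ℝ} (hH : 0 < H) {V : Set E} (hV : IsOpen V) (hSV : S ⊆ V) {p : ℝ → E → ℝ≥0}
    (hpm : ∀ t ∈ Icc 0 H, Measurable (p t))
    (hpc : ContinuousOn (fun q : E × ℝ => p q.2 q.1) (V ×ˢ Icc 0 H)) :
    Tendsto (fun N : ℕ => ∑ k ∈ Finset.range N,
        ∫⁻ x in flowTube ψ S (H / N), (p (k * (H / N)) x : ℝ≥0∞)) atTop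
      (𝓝 (∫⁻ s in Icc 0 H, ∫⁻ z, (p s z : ℝ≥0∞) ∂fluxMeasure S ρ v)) := by
  have hev := fun c (hc : 1 < c) =>
    eventually_sum_flowTube_bounds h𝒳 hS hv hψ₀ hψ htr hH hV hSV hpm hpc (c := c) hc
  have hMtop : ENNReal.ofReal H * fluxMeasure S ρ v univ ≠ ∞ :=
    ENNReal.mul_ne_top ENNReal.ofReal_ne_top
      (fluxMeasure_univ_lt_top h𝒳 hS hv hψ₀ hψ htr).ne
  set M := ENNReal.ofReal H * fluxMeasure S ρ v univ
  set L := ∫⁻ s in Icc 0 H, ∫⁻ z, (p s z : ℝ≥0∞) ∂fluxMeasure S ρ v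
  have hc1 : Tendsto (fun c : ℝ => ENNReal.ofReal c) (𝓝[>] 1) (𝓝 1) := by
    have := (ENNReal.continuous_ofReal.tendsto 1).mono_left (nhdsWithin_le_nhds (s := Ioi (1 : ℝ)))
    simpa using this
  have hc0 : Tendsto (fun c : ℝ => ENNReal.ofReal (c - 1)) (𝓝[>] 1) (𝓝 0) := by
    have hcont : Continuous fun c : ℝ => ENNReal.ofReal (c - 1) :=
      ENNReal.continuous_ofReal.comp (continuous_sub_right 1)
    have := (hcont.tendsto 1).mono_left (nhdsWithin_le_nhds (s := Ioi (1 : ℝ)))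
    simpa using this
  have hlim : ∀ b : ℝ≥0∞, ∀ f : ℝ → ℝ≥0∞, Tendsto f (𝓝[>] 1) (𝓝 0) →
      Tendsto (fun c : ℝ => ENNReal.ofReal c * (b + f c)) (𝓝[>] 1) (𝓝 b) := by
    intro b f hf
    have := ENNReal.Tendsto.mul hc1 (Or.inl one_ne_zero) (tendsto_const_nhds (x := b) |>.add hf)
      (Or.inr ENNReal.one_ne_top)
    simpa using this
  have herr1 : Tendsto (fun c : ℝ => ENNReal.ofReal (c - 1) * M) (𝓝[>] 1) (𝓝 0) := by
    have := ENNReal.Tendsto.mul_const hc0 (Or.inr hMtop)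
    simpa using this
  have herr2 : Tendsto (fun c : ℝ => ENNReal.ofReal (c - 1) * (ENNReal.ofReal c * M))
      (𝓝[>] 1) (𝓝 0) := by
    have h1 := ENNReal.Tendsto.mul_const (b := M) hc1 (Or.inl one_ne_zero)
    rw [one_mul] at h1
    have := ENNReal.Tendsto.mul hc0 (Or.inr hMtop) h1 (Or.inr ENNReal.zero_ne_top)
    simpa using this
  refine tendsto_order.2 ⟨fun b hb => ?_, fun b hb => ?_⟩
  · obtain ⟨c, hcb, hc⟩ := (((hlim b _ herr2).eventually_lt_const hb).and
      self_mem_nhdsWithin).exists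
    filter_upwards [hev c hc] with N hN
    by_contra hcon
    refine absurd (hN.2.trans ?_) (not_le.2 hcb)
    exact mul_le_mul_right (add_le_add_left (not_lt.1 hcon) _) _
  · obtain ⟨c, hcb, hc⟩ := (((hlim L _ herr1).eventually_lt_const hb).and
      self_mem_nhdsWithin).exists
    filter_upwards [hev c hc] with N hN
    exact hN.1.trans_lt hcb

/-- By Tonelli's theorem, the time integral of the flux integrals is the surface integral in the
Kac–Rice formula. -/
theorem lintegral_flux_eq (hS : IsCrossingSurface 𝒳 D S ρ) (hvc : ContinuousOn v S)
    (hfin : fluxMeasure S ρ v univ < ∞)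
    {H : ℝ} {V : Set E} (hSV : S ⊆ V) {p : ℝ → E → ℝ≥0}
    (hpc : ContinuousOn (fun q : E × ℝ => p q.2 q.1) (V ×ˢ Icc 0 H)) :
    ∫⁻ s in Icc 0 H, ∫⁻ z, (p s z : ℝ≥0∞) ∂fluxMeasure S ρ v =
      ∫⁻ x in S, ENNReal.ofReal |inner ℝ (v x) (unitNormal ρ x)| *
        (∫⁻ s in Icc 0 H, (p s x : ℝ≥0∞)) ∂μHE[Module.finrank ℝ E - 1] := by
  have hSm : MeasurableSet S := hS.isCompact.isClosed.measurableSet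
  have : IsFiniteMeasure (fluxMeasure S ρ v) := ⟨hfin⟩
  have hrestr : (fluxMeasure S ρ v).restrict S = fluxMeasure S ρ v :=
    Measure.restrict_eq_self_of_ae_mem
      ((withDensity_absolutelyContinuous _ _).ae_le (ae_restrict_mem hSm))
  have hjoint : AEMeasurable (fun q : E × ℝ => (p q.2 q.1 : ℝ≥0∞))
      ((fluxMeasure S ρ v).prod (volume.restrict (Icc 0 H))) := by
    rw [← hrestr, Measure.prod_restrict]
    exact (ENNReal.continuous_coe.comp_continuousOn
      (hpc.mono (prod_mono_left hSV))).aemeasurable (hSm.prod measurableSet_Icc)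
  rw [← lintegral_lintegral_swap hjoint, fluxMeasure, lintegral_withDensity_eq_lintegral_mul₀']
  · rfl
  · exact (ENNReal.continuous_ofReal.comp_continuousOn
      (hvc.inner hS.continuousOn_unitNormal).abs).aemeasurable hSm
  · exact hjoint.lintegral_prod_right'

end Asymptotics

/-! ### Paths and their crossings -/

section Paths

variable {E 𝒴 Ω : Type*}

section JumpIndex

variable {T : ℕ → Ω → ℝ} {ω : Ω}

theorem jumpIndex_eq (hmono : Monotone fun n => T n ω) {t : ℝ} {n : ℕ} (h1 : T n ω ≤ t)
    (h2 : t < T (n + 1) ω) : jumpIndex T t ω = n := by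
  have : {k : ℕ | T k ω ≤ t} = Iic n := by
    ext k
    refine ⟨fun hk => ?_, fun hk => (hmono hk).trans h1⟩
    by_contra hkn
    exact absurd (h2.trans_le (hmono (Nat.succ_le_of_lt (not_le.1 hkn)))) (not_lt.2 hk)
  rw [jumpIndex, this, csSup_Iic]

theorem exists_jump_le_lt (h0 : T 0 ω = 0) (htop : Tendsto (fun n => T n ω) atTop atTop)
    {t : ℝ} (ht : 0 ≤ t) : ∃ n, T n ω ≤ t ∧ t < T (n + 1) ω := by
  classical
  have hex : ∃ n, t < T n ω := (htop.eventually_gt_atTop t).exists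
  obtain ⟨m, hm⟩ : ∃ m, Nat.find hex = m + 1 := by
    refine Nat.exists_eq_succ_of_ne_zero fun h => ?_
    have := Nat.find_spec hex
    rw [h, h0] at this
    exact absurd this (not_lt.2 ht)
  refine ⟨m, not_lt.1 (Nat.find_min hex (by omega)), ?_⟩
  rw [← hm]
  exact Nat.find_spec hex

theorem exists_jump_lt_le (h0 : T 0 ω = 0) (htop : Tendsto (fun n => T n ω) atTop atTop)
    {t : ℝ} (ht : 0 < t) : ∃ n, T n ω < t ∧ t ≤ T (n + 1) ω := by
  classical
  have hex : ∃ n, t ≤ T n ω := (htop.eventually_ge_atTop t).exists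
  obtain ⟨m, hm⟩ : ∃ m, Nat.find hex = m + 1 := by
    refine Nat.exists_eq_succ_of_ne_zero fun h => ?_
    have := Nat.find_spec hex
    rw [h, h0] at this
    exact absurd this (not_le.2 ht)
  refine ⟨m, not_le.1 (Nat.find_min hex (by omega)), ?_⟩
  rw [← hm]
  exact Nat.find_spec hex

theorem finite_jumps_le (htop : Tendsto (fun n => T n ω) atTop atTop) (t : ℝ) :
    {n : ℕ | T n ω ≤ t}.Finite := by
  obtain ⟨N, hN⟩ := eventually_atTop.1 (htop.eventually_gt_atTop t)
  exact (finite_lt_nat N).subset fun n hn => not_le.1 fun h => absurd (hN n h) (not_lt.2 hn)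

end JumpIndex

theorem grid_index_unique {h s : ℝ} {k l : ℕ} (hk : s ∈ Ioc (k * h) (k * h + h))
    (hl : s ∈ Ioc (l * h) (l * h + h)) : k = l := by
  have hh : 0 < h := by linarith [hk.1, hk.2]
  have h1 : (k : ℝ) < l + 1 := by
    refine lt_of_mul_lt_mul_right (a := h) ?_ hh.le
    linarith [hk.1, hl.2]
  have h2 : (l : ℝ) < k + 1 := by
    refine lt_of_mul_lt_mul_right (a := h) ?_ hh.le
    linarith [hl.1, hk.2]
  have h1' : k < l + 1 := by exact_mod_cast h1
  have h2' : l < k + 1 := by exact_mod_cast h2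
  omega

theorem exists_grid_index {h s : ℝ} {N : ℕ} (hh : 0 < h) (hs : s ∈ Ioc 0 (N * h)) :
    ∃ k < N, s ∈ Ioc (k * h) (k * h + h) := by
  obtain ⟨m, hm⟩ : ∃ m, ⌈s / h⌉₊ = m + 1 :=
    Nat.exists_eq_succ_of_ne_zero (Nat.ceil_pos.2 (div_pos hs.1 hh)).ne'
  have h1 := Nat.le_ceil (s / h)
  have h2 := Nat.ceil_lt_add_one (div_pos hs.1 hh).le
  have h3 : ⌈s / h⌉₊ ≤ N := Nat.ceil_le.2 ((div_le_iff₀ hh).2 hs.2)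
  rw [hm] at h1 h2 h3
  push_cast at h1 h2
  rw [div_le_iff₀ hh] at h1
  have h4 : (m : ℝ) < s / h := by linarith
  rw [lt_div_iff₀ hh] at h4
  exact ⟨m, by omega, h4, by linarith⟩

variable {φ : 𝒴 → E → ℝ → E} {T : ℕ → Ω → ℝ} {M : ℕ → Ω → E × 𝒴} {ω : Ω}

/-- The trajectory that the process follows on `[T n, T (n + 1))`, extended to all times. -/
def piece (φ : 𝒴 → E → ℝ → E) (T : ℕ → Ω → ℝ) (M : ℕ → Ω → E × 𝒴) (n : ℕ) (t : ℝ) (ω : Ω) : E :=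
  φ (M n ω).2 (M n ω).1 (t - T n ω)

theorem euclideanPart_eq_piece (hmono : Monotone fun n => T n ω) {t : ℝ} {n : ℕ}
    (h1 : T n ω ≤ t) (h2 : t < T (n + 1) ω) :
    euclideanPart φ T M t ω = piece φ T M n t ω := by
  rw [euclideanPart, jumpIndex_eq hmono h1 h2, piece]

theorem modePart_eq (hmono : Monotone fun n => T n ω) {t : ℝ} {n : ℕ}
    (h1 : T n ω ≤ t) (h2 : t < T (n + 1) ω) : modePart T M t ω = (M n ω).2 := by
  rw [modePart, jumpIndex_eq hmono h1 h2]

section NormedSpace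

variable [NormedAddCommGroup E] [NormedSpace ℝ E]

theorem continuous_piece {𝒳 : Set E} {r : 𝒴 → E → E}
    (hφ : IsModeFlow 𝒳 r φ) (hM : ∀ n, (M n ω).1 ∈ 𝒳) (n : ℕ) :
    Continuous fun t => piece φ T M n t ω :=
  (hφ.continuous_flow _ (hM n)).comp (continuous_sub_right _)

/-- Starting at `x` in mode `y`, the flow reaches `S` within `(0, h]`. -/
def Reaches (φ : 𝒴 → E → ℝ → E) (S : Set E) (h : ℝ) (y : 𝒴) (x : E) : Prop :=
  ∃ u ∈ Ioc 0 h, φ y x u ∈ S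

theorem reaches_iff_piece {𝒳 : Set E} {r : 𝒴 → E → E} (h𝒳 : IsOpen 𝒳) (hφ : IsModeFlow 𝒳 r φ)
    (hmono : Monotone fun n => T n ω) (hM : ∀ n, (M n ω).1 ∈ 𝒳) {t h : ℝ} {n : ℕ}
    (h1 : T n ω ≤ t) (h2 : t < T (n + 1) ω) :
    Reaches φ S h (modePart T M t ω) (euclideanPart φ T M t ω) ↔
      ∃ s ∈ Ioc t (t + h), piece φ T M n s ω ∈ S := by
  have key : ∀ u, φ (modePart T M t ω) (euclideanPart φ T M t ω) u = piece φ T M n (t + u) ω := by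
    intro u
    rw [modePart_eq hmono h1 h2, euclideanPart_eq_piece hmono h1 h2, piece,
      hφ.flow_add h𝒳 _ (hM n), piece]
    congr 1
    ring
  constructor
  · rintro ⟨u, hu, hmem⟩
    exact ⟨t + u, ⟨by linarith [hu.1], by linarith [hu.2]⟩, by rwa [← key]⟩
  · rintro ⟨s, hs, hmem⟩
    refine ⟨s - t, ⟨by linarith [hs.1], by linarith [hs.2]⟩, ?_⟩
    rwa [key, add_sub_cancel]

end NormedSpace

variable [NormedAddCommGroup E] [InnerProductSpace ℝ E] [CompleteSpace E]
  {𝒳 D S : Set E} {ρ : E → ℝ} {r : 𝒴 → E → E}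

/-- By transversality, `ρ` has nonzero derivative along a trajectory that is in `S`, so visits to
`S` are isolated. -/
theorem eventually_flow_notMem (h𝒳 : IsOpen 𝒳) (hφ : IsModeFlow 𝒳 r φ)
    (hS : IsCrossingSurface 𝒳 D S ρ)
    (htr : ∀ y, ∀ x ∈ S, inner ℝ (r y x) (unitNormal ρ x) ≠ 0)
    {y : 𝒴} {x : E} (hx : x ∈ 𝒳) {t : ℝ} (ht : φ y x t ∈ S) :
    ∀ᶠ s in 𝓝[≠] t, φ y x s ∉ S := by
  have hρ : HasFDerivAt ρ (fderiv ℝ ρ (φ y x t)) (φ y x t) :=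
    (hS.contDiff.differentiable (by simp) _).hasFDerivAt
  have hd := hρ.comp_hasDerivAt t (hφ.hasDerivAt y x hx t)
  have hne : fderiv ℝ ρ (φ y x t) (r y (φ y x t)) ≠ 0 := by
    intro h
    apply htr y _ ht
    rw [unitNormal, real_inner_smul_right, real_inner_comm, inner_gradient_left, h, mul_zero]
  filter_upwards [hd.eventually_ne (c := 0) hne] with s hs hsS
  exact hs (hS.eq_zero h𝒳 _ hsS)

theorem isContinuousCrossing_flow_iff (h𝒳 : IsOpen 𝒳) (hφ : IsModeFlow 𝒳 r φ)
    (hS : IsCrossingSurface 𝒳 D S ρ)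
    (htr : ∀ y, ∀ x ∈ S, inner ℝ (r y x) (unitNormal ρ x) ≠ 0)
    {y : 𝒴} {x : E} (hx : x ∈ 𝒳) {s : ℝ} (hs : 0 < s) :
    IsContinuousCrossing S (φ y x) s ↔ φ y x s ∈ S := by
  refine ⟨fun h => h.2.2.1, fun h => ⟨hs, ?_, h, ?_⟩⟩
  · exact (hφ.continuous_flow y hx).continuousAt.mono_left nhdsWithin_le_nhds
  · obtain ⟨δ, hδ, hball⟩ :=
      Metric.mem_nhdsWithin_iff.1 (eventually_flow_notMem h𝒳 hφ hS htr hx h)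
    rw [Real.ball_eq_Ioo] at hball
    exact ⟨δ, hδ, fun t ht => hball ht⟩

theorem eventually_piece_notMem (h𝒳 : IsOpen 𝒳) (hφ : IsModeFlow 𝒳 r φ)
    (hS : IsCrossingSurface 𝒳 D S ρ)
    (htr : ∀ y, ∀ x ∈ S, inner ℝ (r y x) (unitNormal ρ x) ≠ 0)
    (hM : ∀ n, (M n ω).1 ∈ 𝒳) {n : ℕ} {t : ℝ} (ht : piece φ T M n t ω ∈ S) :
    ∀ᶠ s in 𝓝[≠] t, piece φ T M n s ω ∉ S := by
  have h := eventually_flow_notMem h𝒳 hφ hS htr (hM n) ht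
  have hmap : Tendsto (fun s => s - T n ω) (𝓝[≠] t) (𝓝[≠] (t - T n ω)) :=
    tendsto_nhdsWithin_of_tendsto_nhds_of_eventually_within _
      ((continuous_sub_right _).continuousAt.mono_left nhdsWithin_le_nhds)
      (eventually_mem_nhdsWithin.mono fun s hs => by simpa [sub_left_inj] using hs)
  exact hmap.eventually h

/-- A continuous crossing happens exactly when the trajectory of the current piece arrives in `S`,
even if the mode changes at that time: as the path does not jump from or to `S`, it is continuous
there, and by transversality it leaves `S` at once. -/
theorem isContinuousCrossing_iff_piece_mem (h𝒳 : IsOpen 𝒳) (hφ : IsModeFlow 𝒳 r φ)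
    (hS : IsCrossingSurface 𝒳 D S ρ)
    (htr : ∀ y, ∀ x ∈ S, inner ℝ (r y x) (unitNormal ρ x) ≠ 0)
    (h0 : T 0 ω = 0) (hmono : Monotone fun n => T n ω)
    (htop : Tendsto (fun n => T n ω) atTop atTop) (hM : ∀ n, (M n ω).1 ∈ 𝒳)
    {s : ℝ} (hs : 0 < s)
    (hjump : ∀ x₀ : E, Tendsto (fun t => euclideanPart φ T M t ω) (𝓝[<] s) (𝓝 x₀) →
      x₀ ≠ euclideanPart φ T M s ω → x₀ ∉ S ∧ euclideanPart φ T M s ω ∉ S)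
    {n : ℕ} (h1 : T n ω < s) (h2 : s ≤ T (n + 1) ω) :
    IsContinuousCrossing S (fun t => euclideanPart φ T M t ω) s ↔ piece φ T M n s ω ∈ S := by
  have hleft : (fun t => euclideanPart φ T M t ω) =ᶠ[𝓝[<] s] fun t => piece φ T M n t ω := by
    filter_upwards [Ioo_mem_nhdsLT h1] with t ht
    exact euclideanPart_eq_piece hmono ht.1.le (ht.2.trans_le h2)
  have hlim : Tendsto (fun t => euclideanPart φ T M t ω) (𝓝[<] s) (𝓝 (piece φ T M n s ω)) :=
    Tendsto.congr' hleft.symm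
      ((continuous_piece hφ hM n).continuousAt.mono_left nhdsWithin_le_nhds)
  constructor
  · rintro ⟨-, hcont, hmem, -⟩
    rwa [tendsto_nhds_unique hlim hcont]
  · intro hmem
    have heq : piece φ T M n s ω = euclideanPart φ T M s ω := by
      by_contra hne
      exact (hjump _ hlim hne).1 hmem
    refine ⟨hs, by rwa [heq] at hlim, by rwa [heq] at hmem, ?_⟩
    obtain ⟨m, hm1, hm2⟩ := exists_jump_le_lt h0 htop hs.le
    have hright : (fun t => euclideanPart φ T M t ω) =ᶠ[𝓝[>] s] fun t => piece φ T M m t ω := by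
      filter_upwards [Ioo_mem_nhdsGT hm2] with t ht
      exact euclideanPart_eq_piece hmono (hm1.trans ht.1.le) ht.2
    have hmem' : piece φ T M m s ω ∈ S := by
      rwa [← euclideanPart_eq_piece hmono hm1 hm2, ← heq]
    have hev : ∀ᶠ t in 𝓝[≠] s, euclideanPart φ T M t ω ∉ S := by
      rw [← nhdsLT_sup_nhdsGT, eventually_sup]
      constructor
      · filter_upwards [hleft, (eventually_piece_notMem h𝒳 hφ hS htr hM hmem).filter_mono
          (nhdsWithin_mono _ fun t (ht : t < s) => ht.ne)] with t ht1 ht2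
        rwa [ht1]
      · filter_upwards [hright, (eventually_piece_notMem h𝒳 hφ hS htr hM hmem').filter_mono
          (nhdsWithin_mono _ fun t (ht : s < t) => ht.ne')] with t ht1 ht2
        rwa [ht1]
    obtain ⟨δ, hδ, hball⟩ := Metric.mem_nhdsWithin_iff.1 hev
    rw [Real.ball_eq_Ioo] at hball
    exact ⟨δ, hδ, fun t ht => hball ht⟩

open Classical in
/-- The steps of the grid of mesh `H / N` in which the flow, started at the state of the process at
the left end of the step, reaches `S`. -/
noncomputable def reachingSteps (φ : 𝒴 → E → ℝ → E) (S : Set E) (T : ℕ → Ω → ℝ)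
    (M : ℕ → Ω → E × 𝒴) (H : ℝ) (N : ℕ) (ω : Ω) : Finset ℕ :=
  (Finset.range N).filter fun k => Reaches φ S (H / N)
    (modePart T M (k * (H / N)) ω) (euclideanPart φ T M (k * (H / N)) ω)

theorem encard_hits_le (h𝒳 : IsOpen 𝒳) (hφ : IsModeFlow 𝒳 r φ)
    (hS : IsCrossingSurface 𝒳 D S ρ)
    (htr : ∀ y, ∀ x ∈ S, inner ℝ (r y x) (unitNormal ρ x) ≠ 0) {H : ℝ} {K : ℕ}
    (hK : ∀ y, ∀ x ∈ 𝒳, crossingCount S (φ y x) H ≤ K) {y : 𝒴} {x : E} (hx : x ∈ 𝒳) :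
    {s ∈ Ioc 0 H | φ y x s ∈ S}.encard ≤ K := by
  refine (encard_le_encard ?_).trans (hK y x hx)
  rintro s ⟨hs, hsS⟩
  exact ⟨Ioc_subset_Icc_self hs, (isContinuousCrossing_flow_iff h𝒳 hφ hS htr hx hs.1).2 hsS⟩

/-- Within the time during which one piece is followed, each reaching step yields its own visit of
the piece to `S`, and there are at most `K` of these. -/
theorem card_reachingSteps_le (h𝒳 : IsOpen 𝒳) (hφ : IsModeFlow 𝒳 r φ)
    (hS : IsCrossingSurface 𝒳 D S ρ)
    (htr : ∀ y, ∀ x ∈ S, inner ℝ (r y x) (unitNormal ρ x) ≠ 0)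
    (h0 : T 0 ω = 0) (hmono : Monotone fun n => T n ω)
    (htop : Tendsto (fun n => T n ω) atTop atTop) (hM : ∀ n, (M n ω).1 ∈ 𝒳)
    {H : ℝ} (hH : 0 < H) {K : ℕ} (hK : ∀ y, ∀ x ∈ 𝒳, crossingCount S (φ y x) H ≤ K) (N : ℕ) :
    ((reachingSteps φ S T M H N ω).card : ℕ∞) ≤ K * {n : ℕ | T n ω ≤ H}.encard := by
  classical
  set h := H / N with hh
  have hfin := finite_jumps_le htop H
  -- Each step is assigned to the piece of the path followed at its left end.
  have hspec : ∀ k ∈ reachingSteps φ S T M H N ω, ∃ n, T n ω ≤ k * h ∧ k * h < T (n + 1) ω ∧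
      jumpIndex T (k * h) ω = n ∧ k * h + h ≤ H ∧
        ∃ s ∈ Ioc (k * h) (k * h + h), piece φ T M n s ω ∈ S := by
    intro k hk
    obtain ⟨hkN, hk⟩ := Finset.mem_filter.1 hk
    have hN : (0 : ℝ) < N := by exact_mod_cast (Nat.zero_le k).trans_lt (Finset.mem_range.1 hkN)
    have hhpos : 0 < h := by positivity
    obtain ⟨n, h1, h2⟩ := exists_jump_le_lt h0 htop (t := k * h) (by positivity)
    refine ⟨n, h1, h2, jumpIndex_eq hmono h1 h2, ?_,
      (reaches_iff_piece h𝒳 hφ hmono hM h1 h2).1 hk⟩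
    have hkN' : (k : ℝ) + 1 ≤ N := by exact_mod_cast Finset.mem_range.1 hkN
    calc k * h + h = (k + 1) * h := by ring
      _ ≤ N * h := by gcongr
      _ = H := by rw [hh]; field_simp
  have hcard : (reachingSteps φ S T M H N ω).card ≤ K * hfin.toFinset.card := by
    refine Finset.card_le_mul_card_image_of_maps_to (f := fun k : ℕ => jumpIndex T (k * h) ω)
      (fun k hk => ?_) K (fun n _ => ?_)
    · obtain ⟨n, h1, -, h3, h4, s, hs, -⟩ := hspec k hk
      rw [hfin.mem_toFinset]
      change T (jumpIndex T (k * h) ω) ω ≤ H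
      rw [h3]
      linarith [hs.1, hs.2]
    · have hchoose : ∀ k ∈ (reachingSteps φ S T M H N ω).filter
          (fun k : ℕ => jumpIndex T (k * h) ω = n), ∃ s ∈ Ioc (k * h) (k * h + h),
          s - T n ω ∈ {s ∈ Ioc 0 H | φ (M n ω).2 (M n ω).1 s ∈ S} := by
        intro k hk
        obtain ⟨hk, hkn⟩ := Finset.mem_filter.1 hk
        obtain ⟨m, h1, -, h3, h4, s, hs, hsS⟩ := hspec k hk
        obtain rfl : m = n := h3.symm.trans hkn
        have hTm : 0 ≤ T m ω := h0 ▸ hmono (Nat.zero_le m)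
        exact ⟨s, hs, ⟨by linarith [hs.1], by linarith [hs.2]⟩, hsS⟩
      choose! σ hσ1 hσ2 using hchoose
      have hle := (encard_le_encard_of_injOn (f := fun k => σ k - T n ω)
        (s := ((reachingSteps φ S T M H N ω).filter
          (fun k : ℕ => jumpIndex T (k * h) ω = n) : Set ℕ)) (fun k hk => hσ2 k hk)
        (fun k hk l hl hkl => grid_index_unique (hσ1 k hk) (by
          have : σ k = σ l := by simpa using hkl
          rw [this]
          exact hσ1 l hl))).trans (encard_hits_le h𝒳 hφ hS htr hK (hM n))
      rw [encard_coe_eq_coe_finsetCard] at hle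
      exact_mod_cast hle
  rw [hfin.encard_eq_coe_toFinset_card]
  exact_mod_cast hcard

/-- On a fine grid, the steps in which the flow of the current mode reaches `S` correspond to the
continuous crossings. A mesh is fine enough if it separates the crossings from each other and from
the preceding jumps, and if no piece, continued beyond its end, meets `S` within one mesh length. -/
theorem eventually_card_reachingSteps_eq (h𝒳 : IsOpen 𝒳) (hφ : IsModeFlow 𝒳 r φ)
    (hS : IsCrossingSurface 𝒳 D S ρ) (hSc : IsClosed S)
    (htr : ∀ y, ∀ x ∈ S, inner ℝ (r y x) (unitNormal ρ x) ≠ 0)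
    (h0 : T 0 ω = 0) (hmono : Monotone fun n => T n ω)
    (htop : Tendsto (fun n => T n ω) atTop atTop) (hM : ∀ n, (M n ω).1 ∈ 𝒳)
    {H : ℝ} (hH : 0 < H) {K : ℕ} (hK : ∀ y, ∀ x ∈ 𝒳, crossingCount S (φ y x) H ≤ K)
    (hjump : ∀ s ∈ Ioc 0 H, ∀ x₀ : E,
      Tendsto (fun t => euclideanPart φ T M t ω) (𝓝[<] s) (𝓝 x₀) →
      x₀ ≠ euclideanPart φ T M s ω → x₀ ∉ S ∧ euclideanPart φ T M s ω ∉ S) :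
    ∀ᶠ N : ℕ in atTop, ((reachingSteps φ S T M H N ω).card : ℕ∞) =
      crossingCount S (fun t => euclideanPart φ T M t ω) H := by
  classical
  set G := {s ∈ Icc 0 H | IsContinuousCrossing S (fun t => euclideanPart φ T M t ω) s} with hG
  have hGiff : ∀ n s, s ≤ H → 0 ≤ T n ω → T n ω < s → s ≤ T (n + 1) ω →
      (s ∈ G ↔ piece φ T M n s ω ∈ S) := by
    intro n s hsH hTn h1 h2
    have hs0 : 0 < s := hTn.trans_lt h1
    rw [← isContinuousCrossing_iff_piece_mem h𝒳 hφ hS htr h0 hmono htop hM hs0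
      (hjump s ⟨hs0, hsH⟩) h1 h2]
    exact ⟨fun h => h.2, fun h => ⟨⟨hs0.le, hsH⟩, h⟩⟩
  have hT0 : ∀ n, 0 ≤ T n ω := fun n => h0 ▸ hmono (Nat.zero_le n)
  have hJ := finite_jumps_le htop H
  have hGpiece : ∀ s ∈ G, ∃ n, T n ω < s ∧ s ≤ T (n + 1) ω ∧ piece φ T M n s ω ∈ S := by
    intro s hs
    obtain ⟨n, h1, h2⟩ := exists_jump_lt_le h0 htop hs.2.1
    exact ⟨n, h1, h2, (hGiff n s hs.1.2 (hT0 n) h1 h2).1 hs⟩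
  choose! ι hι1 hι2 hι3 using hGpiece
  have hGfin : G.Finite := by
    have hfin : (⋃ n ∈ {n : ℕ | T n ω ≤ H}, (fun s => s + T n ω) ''
        {s ∈ Ioc 0 H | φ (M n ω).2 (M n ω).1 s ∈ S}).Finite := by
      refine hJ.biUnion fun n _ => Finite.image _ ?_
      refine finite_of_encard_le_coe (k := K) (encard_hits_le h𝒳 hφ hS htr hK (hM n))
    refine hfin.subset fun s hs => ?_
    have hsH : s ≤ H := hs.1.2
    simp only [mem_iUnion]
    refine ⟨ι s, (hι1 s hs).le.trans hsH, s - T (ι s) ω, ⟨⟨?_, ?_⟩, hι3 s hs⟩, by simp⟩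
    · linarith [hι1 s hs]
    · linarith [hT0 (ι s)]
  have hmesh : Tendsto (fun N : ℕ => H / N) atTop (𝓝[>] 0) :=
    tendsto_nhdsWithin_of_tendsto_nhds_of_eventually_within _
      (tendsto_const_div_atTop_nhds_zero_nat H)
      ((eventually_gt_atTop 0).mono fun N hN => div_pos hH (by exact_mod_cast hN))
  have hev1 : ∀ᶠ h in 𝓝[>] (0 : ℝ), ∀ s ∈ G, h < s - T (ι s) ω :=
    (eventually_all_finite hGfin).2 fun s hs =>
      (eventually_lt_nhds (sub_pos.2 (hι1 s hs))).filter_mono nhdsWithin_le_nhds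
  have hev2 : ∀ᶠ h in 𝓝[>] (0 : ℝ), ∀ s ∈ G, ∀ s' ∈ G, s ≠ s' → h < |s - s'| := by
    refine (eventually_all_finite hGfin).2 fun s _ =>
      (eventually_all_finite hGfin).2 fun s' _ => ?_
    by_cases hss : s = s'
    · exact Eventually.of_forall fun h hne => absurd hss hne
    · exact ((eventually_lt_nhds (abs_pos.2 (sub_ne_zero.2 hss))).filter_mono
        nhdsWithin_le_nhds).mono fun h hlt _ => hlt
  have hev3 : ∀ᶠ h in 𝓝[>] (0 : ℝ), ∀ n ∈ {n : ℕ | T n ω ≤ H},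
      ∀ s ∈ Ioc (T (n + 1) ω) (T (n + 1) ω + h), piece φ T M n s ω ∉ S := by
    refine (eventually_all_finite hJ).2 fun n _ => ?_
    have hright : ∀ᶠ s in 𝓝[>] (T (n + 1) ω), piece φ T M n s ω ∉ S := by
      by_cases hmem : piece φ T M n (T (n + 1) ω) ω ∈ S
      · exact (eventually_piece_notMem h𝒳 hφ hS htr hM hmem).filter_mono
          (nhdsWithin_mono _ fun t (ht : _ < t) => ht.ne')
      · exact ((continuous_piece hφ hM n).continuousAt.eventually
          (hSc.isOpen_compl.mem_nhds hmem)).filter_mono nhdsWithin_le_nhds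
    obtain ⟨b, hb, hbS⟩ := mem_nhdsGT_iff_exists_Ioo_subset.1 hright
    have hb' : 0 < b - T (n + 1) ω := sub_pos.2 hb
    filter_upwards [(eventually_lt_nhds hb').filter_mono nhdsWithin_le_nhds] with h hh s hs
    exact hbS ⟨hs.1, by linarith [hs.2]⟩
  filter_upwards [hmesh.eventually hev1, hmesh.eventually hev2, hmesh.eventually hev3,
    eventually_gt_atTop 0] with N hN1 hN2 hN3 hN0
  set h := H / N with hh
  have hN0' : (0 : ℝ) < N := by exact_mod_cast hN0
  have hhpos : 0 < h := by positivity
  have hNh : N * h = H := by rw [hh]; field_simp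
  change _ = G.encard
  rw [← encard_coe_eq_coe_finsetCard]
  apply le_antisymm
  -- A reaching step contains a crossing: by the choice of the mesh, the piece followed at its left
  -- end is still the current one when it reaches `S`.
  · have hchoose : ∀ k ∈ reachingSteps φ S T M H N ω, ∃ s ∈ Ioc (k * h) (k * h + h), s ∈ G := by
      intro k hk
      obtain ⟨hkN, hk⟩ := Finset.mem_filter.1 hk
      have hkN' : (k : ℝ) + 1 ≤ N := by exact_mod_cast Finset.mem_range.1 hkN
      have hkH : k * h + h ≤ H := by
        calc k * h + h = (k + 1) * h := by ring
          _ ≤ N * h := by gcongr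
          _ = H := hNh
      obtain ⟨n, h1, h2⟩ := exists_jump_le_lt h0 htop (t := k * h) (by positivity)
      obtain ⟨s, hs, hsS⟩ := (reaches_iff_piece h𝒳 hφ hmono hM h1 h2).1 hk
      refine ⟨s, hs, (hGiff n s (hs.2.trans hkH) (hT0 n) (h1.trans_lt hs.1) ?_).2 hsS⟩
      by_contra hlt
      refine hN3 n ?_ s ⟨not_le.1 hlt, by linarith [hs.2]⟩ hsS
      exact h1.trans (by linarith)
    choose! σ hσ1 hσ2 using hchoose
    exact encard_le_encard_of_injOn (f := σ) (fun k hk => hσ2 k hk) fun k hk l hl hkl =>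
      grid_index_unique (hσ1 k hk) (by rw [hkl]; exact hσ1 l hl)
  -- The step that contains a crossing is reaching, since it starts after the preceding jump.
  · have hchoose : ∀ s ∈ G, ∃ k < N, s ∈ Ioc (k * h) (k * h + h) := fun s hs =>
      exists_grid_index hhpos ⟨hs.2.1, hNh.symm ▸ hs.1.2⟩
    choose! κ hκ1 hκ2 using hchoose
    refine encard_le_encard_of_injOn (f := κ) (fun s hs => ?_) fun s hs s' hs' hss => ?_
    · refine Finset.mem_coe.2 (Finset.mem_filter.2 ⟨Finset.mem_range.2 (hκ1 s hs), ?_⟩)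
      have h1 := hN1 s hs
      have h2 := hκ2 s hs
      refine (reaches_iff_piece h𝒳 hφ hmono hM (n := ι s) ?_ ?_).2 ⟨s, h2, hι3 s hs⟩
      · linarith [h2.2]
      · exact h2.1.trans_le (hι2 s hs)
    · by_contra hne
      have h1 := hN2 s hs s' hs' hne
      have h2 := hκ2 s hs
      have h3 := hκ2 s' hs'
      rw [← hss] at h3
      refine absurd h1 (not_lt.2 (abs_le.2 ⟨?_, ?_⟩)) <;> linarith [h2.1, h2.2, h3.1, h3.2]

end Paths

/-! ### Expected number of crossings -/

section Expectation

/-- A subset of a null-measurable set `U` is null-measurable as soon as its outer measure and that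
of its complement in `U` add up to the measure of `U`. -/
theorem nullMeasurableSet_inter_of_measure_add_le {Ω : Type*} [MeasurableSpace Ω] {P : Measure Ω}
    [IsFiniteMeasure P] {U A : Set Ω} (hU : NullMeasurableSet U P)
    (h : P (U ∩ A) + P (U ∩ Aᶜ) ≤ P U) : NullMeasurableSet (U ∩ A) P := by
  set B := toMeasurable P (U ∩ A)
  set C := toMeasurable P (U ∩ Aᶜ)
  have hB : MeasurableSet B := measurableSet_toMeasurable _ _
  have hC : MeasurableSet C := measurableSet_toMeasurable _ _
  have hUB : U ∩ A ⊆ B := subset_toMeasurable _ _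
  have hUC : U ∩ Aᶜ ⊆ C := subset_toMeasurable _ _
  have hBC : P (B ∩ C) = 0 := by
    have h1 : P (B ∪ C) + P (B ∩ C) = P B + P C := measure_union_add_inter B hC
    have h2 : U ⊆ B ∪ C := fun ω hω => by
      by_cases hA : ω ∈ A
      · exact Or.inl (hUB ⟨hω, hA⟩)
      · exact Or.inr (hUC ⟨hω, hA⟩)
    have h3 : P (B ∪ C) + P (B ∩ C) ≤ P (B ∪ C) + 0 := by
      rw [h1, measure_toMeasurable, measure_toMeasurable, add_zero]
      exact h.trans (measure_mono h2)
    exact le_antisymm ((ENNReal.add_le_add_iff_left (measure_ne_top P _)).1 h3) bot_le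
  have hae : (U ∩ A : Set Ω) =ᵐ[P] (B ∩ U : Set Ω) := by
    refine (LE.le.eventuallyLE (show U ∩ A ⊆ B ∩ U from fun ω hω => ⟨hUB hω, hω.1⟩)).antisymm ?_
    rw [ae_le_set]
    refine measure_mono_null ?_ hBC
    rintro ω ⟨⟨hωB, hωU⟩, hω⟩
    exact ⟨hωB, hUC ⟨hωU, fun hA => hω ⟨hωU, hA⟩⟩⟩
  exact (hB.nullMeasurableSet.inter hU).congr hae.symm

theorem nullMeasurableSet_modePart_eq {E 𝒴 Ω : Type*} [MeasurableSpace E] [MeasurableSpace Ω]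
    [MeasurableSpace 𝒴] [MeasurableSingletonClass 𝒴] {P : Measure Ω} {𝒳 : Set E}
    {T : ℕ → Ω → ℝ} {M : ℕ → Ω → E × 𝒴} (hTM : IsMarkedPointProcess P 𝒳 T M) {t : ℝ}
    (ht : 0 ≤ t) (y : 𝒴) : NullMeasurableSet {ω | modePart T M t ω = y} P := by
  have hmeas : MeasurableSet
      (⋃ n, {ω | T n ω ≤ t} ∩ {ω | t < T (n + 1) ω} ∩ {ω | (M n ω).2 = y}) := by
    refine MeasurableSet.iUnion fun n => ((measurableSet_le (hTM.measurable_time n)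
      measurable_const).inter (measurableSet_lt measurable_const
      (hTM.measurable_time (n + 1)))).inter ?_
    exact measurable_snd.comp (hTM.measurable_mark n) (measurableSet_singleton y)
  refine hmeas.nullMeasurableSet.congr (eventuallyEq_set.2 ?_)
  filter_upwards [hTM.time_zero, hTM.time_mono, hTM.time_tendsto] with ω h0 hmono htop
  obtain ⟨n, h1, h2⟩ := exists_jump_le_lt h0 htop ht
  simp only [mem_iUnion, mem_inter_iff, mem_ofPred_eq]
  constructor
  · rintro ⟨m, ⟨hm1, hm2⟩, hy⟩
    rwa [modePart_eq hmono hm1 hm2]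
  · intro hy
    exact ⟨n, ⟨h1, h2⟩, by rwa [modePart_eq hmono h1 h2] at hy⟩

/-- Having a density makes the state of the process measurable up to null sets. -/
theorem HasModeDensity.nullMeasurableSet {E 𝒴 Ω : Type*} [MeasureSpace E] [MeasurableSpace Ω]
    {P : Measure Ω} [IsFiniteMeasure P] {X : Ω → E} {Y : Ω → 𝒴} {p : E → 𝒴 → ℝ≥0}
    (hp : HasModeDensity P X Y p) {y : 𝒴} (hY : NullMeasurableSet {ω | Y ω = y} P)
    {A : Set E} (hA : MeasurableSet A) : NullMeasurableSet {ω | X ω ∈ A ∧ Y ω = y} P := by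
  have hset : ∀ B : Set E, {ω | Y ω = y} ∩ X ⁻¹' B = {ω | X ω ∈ B ∧ Y ω = y} := fun B => by
    ext ω
    exact and_comm
  rw [← hset]
  refine nullMeasurableSet_inter_of_measure_add_le hY ?_
  have huniv : {ω | Y ω = y} = {ω | X ω ∈ univ ∧ Y ω = y} := by simp
  rw [← preimage_compl, hset, hset, (hp y).2 A hA, (hp y).2 _ hA.compl,
    lintegral_add_compl _ hA, huniv, (hp y).2 univ MeasurableSet.univ, Measure.restrict_univ]

variable {E 𝒴 Ω : Type*} [NormedAddCommGroup E] [InnerProductSpace ℝ E]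
  {𝒳 : Set E} {r : 𝒴 → E → E} {φ : 𝒴 → E → ℝ → E}

/-- Reaching `S` forwards in time within `(0, h]` is lying in the tube swept out by `S` backwards in
time. -/
theorem reaches_iff_mem_flowTube (h𝒳 : IsOpen 𝒳) (hφ : IsModeFlow 𝒳 r φ) {S : Set E}
    (hS : S ⊆ 𝒳) {y : 𝒴} {x : E} (hx : x ∈ 𝒳) (h : ℝ) :
    Reaches φ S h y x ↔ x ∈ flowTube (fun z t => φ y z (-t)) S h := by
  constructor
  · rintro ⟨u, hu, hmem⟩
    refine ⟨(φ y x u, u), ⟨hmem, hu⟩, ?_⟩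
    simp only
    rw [hφ.flow_add h𝒳 y hx, add_neg_cancel, hφ.initial y x hx]
  · rintro ⟨⟨z, u⟩, ⟨hz, hu⟩, rfl⟩
    refine ⟨u, hu, ?_⟩
    simp only
    rwa [hφ.flow_add h𝒳 y (hS hz), neg_add_cancel, hφ.initial y z (hS hz)]

variable [FiniteDimensional ℝ E] [MeasurableSpace E] [BorelSpace E]

theorem expectedCrossings_eq_sum_flux [MeasurableSpace Ω] {P : Measure Ω} [IsProbabilityMeasure P]
    [Fintype 𝒴] [MeasurableSpace 𝒴] [MeasurableSingletonClass 𝒴]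
    (h𝒳 : IsOpen 𝒳) (hφ : IsModeFlow 𝒳 r φ) {T : ℕ → Ω → ℝ} {M : ℕ → Ω → E × 𝒴}
    (hTM : IsMarkedPointProcess P 𝒳 T M) (hjumps : HasFiniteExpectedJumps P T)
    {D S : Set E} {ρ : E → ℝ} (hS : IsCrossingSurface 𝒳 D S ρ) {H : ℝ} (hH : 0 < H)
    (htr : ∀ y, ∀ x ∈ S, inner ℝ (r y x) (unitNormal ρ x) ≠ 0)
    {K : ℕ} (hK : ∀ y, ∀ x ∈ 𝒳, crossingCount S (φ y x) H ≤ K)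
    (hnojump : NoJumpFromOrTo P S (euclideanPart φ T M) H) {p : ℝ → E → 𝒴 → ℝ≥0}
    (hp : ∀ t ∈ Icc 0 H, HasModeDensity P (euclideanPart φ T M t) (modePart T M t) (p t))
    {V : Set E} (hV : IsOpen V) (hSV : S ⊆ V)
    (hpcont : ∀ y, ContinuousOn (fun q : E × ℝ => p q.2 q.1 y) (V ×ˢ Icc 0 H)) :
    AEMeasurable (fun ω =>
        ((crossingCount S (fun t => euclideanPart φ T M t ω) H : ℕ∞) : ℝ≥0∞)) P ∧
      expectedCrossings P S (euclideanPart φ T M) H < ∞ ∧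
      expectedCrossings P S (euclideanPart φ T M) H =
        ∑ y, ∫⁻ x in S, ENNReal.ofReal |inner ℝ (r y x) (unitNormal ρ x)| *
          (∫⁻ s in Icc 0 H, (p s x y : ℝ≥0∞)) ∂μHE[Module.finrank ℝ E - 1] := by
  classical
  -- The backward flows.
  set v : 𝒴 → E → E := fun y x => -r y x
  set ψ : 𝒴 → E → ℝ → E := fun y z t => φ y z (-t)
  have hv : ∀ y, ContDiffOn ℝ 1 (v y) 𝒳 := fun y => (hφ.contDiffOn y).neg
  have hψ₀ : ∀ y, ∀ z ∈ 𝒳, ψ y z 0 = z := fun y z hz => by simp [ψ, hφ.initial y z hz]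
  have hψ : ∀ y, ∀ z ∈ 𝒳, ∀ t, HasDerivAt (ψ y z) (v y (ψ y z t)) t := fun y z hz t => by
    simpa [ψ, v, Function.comp_def] using
      (hφ.hasDerivAt y z hz (-t)).scomp t (hasDerivAt_neg t)
  have htr' : ∀ y, ∀ x ∈ S, inner ℝ (v y x) (unitNormal ρ x) ≠ 0 := fun y x hx => by
    rw [inner_neg_left]
    exact neg_ne_zero.2 (htr y x hx)
  have hpm : ∀ y, ∀ t ∈ Icc 0 H, Measurable fun x => p t x y := fun y t ht => (hp t ht y).1
  set J : ℝ≥0∞ := ∑ y, ∫⁻ s in Icc 0 H, ∫⁻ z, (p s z y : ℝ≥0∞) ∂fluxMeasure S ρ (v y) with hJ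
  have hJlt : J < ∞ := ENNReal.sum_lt_top.2 fun y _ =>
    lintegral_flux_lt_top h𝒳 hS (hv y) (hψ₀ y) (hψ y) (htr' y) hSV (hpcont y)
  have hJeq : J = ∑ y, ∫⁻ x in S, ENNReal.ofReal |inner ℝ (r y x) (unitNormal ρ x)| *
      (∫⁻ s in Icc 0 H, (p s x y : ℝ≥0∞)) ∂μHE[Module.finrank ℝ E - 1] := by
    refine Finset.sum_congr rfl fun y _ => ?_
    rw [lintegral_flux_eq (p := fun s z => p s z y) hS ((hv y).continuousOn.mono hS.boundary_subset)
      (fluxMeasure_univ_lt_top h𝒳 hS (hv y) (hψ₀ y) (hψ y) (htr' y)) hSV (hpcont y)]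
    simp only [v, inner_neg_left, abs_neg]
  have hlimJ : Tendsto (fun N : ℕ => ∑ y, ∑ k ∈ Finset.range N,
      ∫⁻ x in flowTube (ψ y) S (H / N), (p (k * (H / N)) x y : ℝ≥0∞)) atTop (𝓝 J) :=
    tendsto_finsetSum _ fun y _ => tendsto_sum_flowTube (p := fun s z => p s z y) h𝒳 hS (hv y)
      (hψ₀ y) (hψ y) (htr' y) hH hV hSV (hpm y) (hpcont y)
  have htube : ∀ᶠ N : ℕ in atTop, ∀ y, MeasurableSet (flowTube (ψ y) S (H / N)) := by
    refine eventually_all.2 fun y => ?_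
    obtain ⟨h₀, hh₀, -, hb⟩ := exists_lintegral_flowTube_bounds h𝒳 hS (hv y) (hψ₀ y) (hψ y)
      (htr' y) one_lt_two
    filter_upwards [(tendsto_const_div_atTop_nhds_zero_nat H).eventually
      (eventually_le_nhds hh₀)] with N hN using (hb _ hN).1
  -- The number of reaching steps is a sum of indicators of events given by the densities.
  set c : ℕ → Ω → ℝ≥0∞ := fun N ω => ((reachingSteps φ S T M H N ω).card : ℝ≥0∞) with hc
  set A : ℕ → ℕ → 𝒴 → Set Ω := fun N k y =>
    {ω | euclideanPart φ T M (k * (H / N)) ω ∈ flowTube (ψ y) S (H / N) ∧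
      modePart T M (k * (H / N)) ω = y} with hA
  have hgridH : ∀ N : ℕ, ∀ k ∈ Finset.range N, (k * (H / N) : ℝ) ∈ Icc 0 H := by
    intro N k hk
    have hkN : (k : ℝ) ≤ N := by exact_mod_cast (Finset.mem_range.1 hk).le
    have hN : (0 : ℝ) < N := by exact_mod_cast (Nat.zero_le k).trans_lt (Finset.mem_range.1 hk)
    refine ⟨by positivity, ?_⟩
    calc k * (H / N) ≤ N * (H / N) := by gcongr
      _ = H := by field_simp
  have hAnull : ∀ N : ℕ, (∀ y, MeasurableSet (flowTube (ψ y) S (H / N))) →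
      ∀ k ∈ Finset.range N, ∀ y, NullMeasurableSet (A N k y) P := fun N hN k hk y =>
    (hp _ (hgridH N k hk)).nullMeasurableSet
      (nullMeasurableSet_modePart_eq hTM (hgridH N k hk).1 y) (hN y)
  have hcae : ∀ N, c N =ᵐ[P] fun ω =>
      ∑ y, ∑ k ∈ Finset.range N, (A N k y).indicator (fun _ => (1 : ℝ≥0∞)) ω := by
    intro N
    filter_upwards [hTM.time_zero, hTM.time_mono, hTM.time_tendsto, hTM.mark_mem]
      with ω h0 hmono htop hM
    simp only [hc, reachingSteps, Finset.card_filter, Nat.cast_sum]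
    rw [Finset.sum_comm]
    refine Finset.sum_congr rfl fun k hk => ?_
    have ht := (hgridH N k hk).1
    obtain ⟨n, h1, h2⟩ := exists_jump_le_lt h0 htop ht
    have hX : euclideanPart φ T M (k * (H / N)) ω ∈ 𝒳 := by
      rw [euclideanPart_eq_piece hmono h1 h2]
      exact hφ.mem _ _ (hM n) _
    rw [Finset.sum_eq_single (modePart T M (k * (H / N)) ω)]
    · rw [reaches_iff_mem_flowTube h𝒳 hφ hS.boundary_subset hX]
      simp [indicator, A, ψ]
    · intro y _ hy
      exact indicator_of_notMem (fun h => hy h.2.symm) _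
    · simp
  have hcmeas : ∀ N : ℕ, (∀ y, MeasurableSet (flowTube (ψ y) S (H / N))) →
      AEMeasurable (c N) P := by
    intro N hN
    refine AEMeasurable.congr ?_ (hcae N).symm
    refine Finset.aemeasurable_fun_sum _ fun y _ => Finset.aemeasurable_fun_sum _ fun k hk => ?_
    exact aemeasurable_const.indicator₀ (hAnull N hN k hk y)
  have hcint : ∀ N : ℕ, (∀ y, MeasurableSet (flowTube (ψ y) S (H / N))) →
      ∫⁻ ω, c N ω ∂P = ∑ y, ∑ k ∈ Finset.range N,
        ∫⁻ x in flowTube (ψ y) S (H / N), (p (k * (H / N)) x y : ℝ≥0∞) := by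
    intro N hN
    have hind : ∀ y, ∀ k ∈ Finset.range N,
        AEMeasurable ((A N k y).indicator fun _ => (1 : ℝ≥0∞)) P := fun y k hk =>
      aemeasurable_const.indicator₀ (hAnull N hN k hk y)
    rw [lintegral_congr_ae (hcae N), lintegral_finsetSum' _ fun y _ =>
      Finset.aemeasurable_fun_sum _ (hind y)]
    refine Finset.sum_congr rfl fun y _ => ?_
    rw [lintegral_finsetSum' _ (hind y)]
    refine Finset.sum_congr rfl fun k hk => ?_
    rw [lintegral_indicator_const₀ (hAnull N hN k hk y), one_mul]
    exact (hp _ (hgridH N k hk) y).2 _ (hN y)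
  -- Dominated convergence as the grid gets finer.
  obtain ⟨N₀, hN₀⟩ := eventually_atTop.1 htube
  set C : Ω → ℝ≥0∞ := fun ω =>
    ((crossingCount S (fun t => euclideanPart φ T M t ω) H : ℕ∞) : ℝ≥0∞) with hC
  set B : Ω → ℝ≥0∞ := fun ω => K * (({n : ℕ | T n ω ≤ H}.encard : ℕ∞) : ℝ≥0∞)
  have hBfin : ∫⁻ ω, B ω ∂P ≠ ∞ := by
    rw [lintegral_const_mul' _ _ (ENNReal.natCast_ne_top K)]
    exact ENNReal.mul_ne_top (ENNReal.natCast_ne_top K) (hjumps H).ne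
  have hbound : ∀ N, c N ≤ᵐ[P] B := by
    intro N
    filter_upwards [hTM.time_zero, hTM.time_mono, hTM.time_tendsto, hTM.mark_mem]
      with ω h0 hmono htop hM
    have := card_reachingSteps_le h𝒳 hφ hS htr h0 hmono htop hM hH hK N
    have h2 := ENat.toENNReal_le.2 this
    simpa [c, B] using h2
  have hlim : ∀ᵐ ω ∂P, Tendsto (fun N => c (N + N₀) ω) atTop (𝓝 (C ω)) := by
    filter_upwards [hTM.time_zero, hTM.time_mono, hTM.time_tendsto, hTM.mark_mem, hnojump]
      with ω h0 hmono htop hM hjump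
    have := eventually_card_reachingSteps_eq h𝒳 hφ hS hS.isCompact.isClosed htr h0 hmono htop hM
      hH hK hjump
    refine (tendsto_add_atTop_iff_nat N₀ (f := fun N => c N ω)).2 ?_
    refine tendsto_const_nhds.congr' ?_
    filter_upwards [this] with N hN
    simp only [C, c, ← hN]
    simp
  have hmeasC : AEMeasurable C P :=
    aemeasurable_of_tendsto_metrizable_ae atTop
      (fun N => hcmeas (N + N₀) (hN₀ _ (Nat.le_add_left _ _))) hlim
  have hconv := tendsto_lintegral_of_dominated_convergence' B
    (fun N => hcmeas (N + N₀) (hN₀ _ (Nat.le_add_left _ _))) (fun N => hbound _) hBfin hlim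
  have hCJ : ∫⁻ ω, C ω ∂P = J := by
    refine tendsto_nhds_unique hconv ?_
    refine ((tendsto_add_atTop_iff_nat N₀).2 hlimJ).congr fun N => ?_
    exact (hcint (N + N₀) (hN₀ _ (Nat.le_add_left _ _))).symm
  refine ⟨hmeasC, ?_, ?_⟩
  · rw [expectedCrossings, hCJ]
    exact hJlt
  · rw [expectedCrossings, hCJ, hJeq]

end Expectation

end PiecewiseSmooth

theorem mainTheorem4 {d : ℕ} (hd : 2 ≤ d)
    {Ω : Type*} [MeasurableSpace Ω] (P : Measure Ω) [IsProbabilityMeasure P]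
    {𝒴 : Type*} [Fintype 𝒴] [MeasurableSpace 𝒴] [MeasurableSingletonClass 𝒴]
    (𝒳 : Set (EuclideanSpace ℝ (Fin d))) (h𝒳 : IsOpen 𝒳)
    (r : 𝒴 → EuclideanSpace ℝ (Fin d) → EuclideanSpace ℝ (Fin d))
    (φ : 𝒴 → EuclideanSpace ℝ (Fin d) → ℝ → EuclideanSpace ℝ (Fin d))
    (hφ : PiecewiseSmooth.IsModeFlow 𝒳 r φ)
    (T : ℕ → Ω → ℝ) (M : ℕ → Ω → EuclideanSpace ℝ (Fin d) × 𝒴)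
    (hTM : PiecewiseSmooth.IsMarkedPointProcess P 𝒳 T M)
    (hjumps : PiecewiseSmooth.HasFiniteExpectedJumps P T)
    (X : ℝ → Ω → EuclideanSpace ℝ (Fin d)) (hX : X = PiecewiseSmooth.euclideanPart φ T M)
    (Y : ℝ → Ω → 𝒴) (hY : Y = PiecewiseSmooth.modePart T M)
    (D S : Set (EuclideanSpace ℝ (Fin d))) (ρ : EuclideanSpace ℝ (Fin d) → ℝ)
    (hS : PiecewiseSmooth.IsCrossingSurface 𝒳 D S ρ)
    (H : ℝ) (hH : 0 ≤ H)
    (htangent : ∀ y, ∀ x ∈ S, inner ℝ (r y x) (PiecewiseSmooth.unitNormal ρ x) ≠ 0)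
    (hflow : ∀ y, ∃ K : ℕ, ∀ x ∈ 𝒳, PiecewiseSmooth.crossingCount S (φ y x) H ≤ K)
    (hnojump : PiecewiseSmooth.NoJumpFromOrTo P S X H)
    (p : ℝ → EuclideanSpace ℝ (Fin d) → 𝒴 → ℝ≥0)
    (hp : ∀ t ∈ Icc 0 H, PiecewiseSmooth.HasModeDensity P (X t) (Y t) (p t))
    (V : Set (EuclideanSpace ℝ (Fin d))) (hV : IsOpen V) (hSV : S ⊆ V)
    (hpcont : ∀ y, ContinuousOn
      (fun q : EuclideanSpace ℝ (Fin d) × ℝ => p q.2 q.1 y) (V ×ˢ Icc 0 H)) :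
    AEMeasurable
        (fun ω => ((PiecewiseSmooth.crossingCount S (fun t => X t ω) H : ℕ∞) : ℝ≥0∞)) P ∧
      PiecewiseSmooth.expectedCrossings P S X H < ∞ ∧
      PiecewiseSmooth.expectedCrossings P S X H =
        ∑ y, ∫⁻ x in S,
          ENNReal.ofReal |inner ℝ (r y x) (PiecewiseSmooth.unitNormal ρ x)| *
            (∫⁻ s in Icc 0 H, (p s x y : ℝ≥0∞)) ∂(Measure.euclideanHausdorffMeasure (d - 1)) := by
  subst hX hY
  rcases hH.eq_or_lt with rfl | hH
  · -- Crossing times are positive, so there are none within `[0, 0]`.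
    have hzero : ∀ z : ℝ → EuclideanSpace ℝ (Fin d), PiecewiseSmooth.crossingCount S z 0 = 0 := by
      intro z
      rw [PiecewiseSmooth.crossingCount, encard_eq_zero, eq_empty_iff_forall_notMem]
      rintro s ⟨hs, hs0, -⟩
      exact absurd hs.2 (not_le.2 hs0)
    simp [PiecewiseSmooth.expectedCrossings, hzero]
  · choose K hK using hflow
    have := PiecewiseSmooth.expectedCrossings_eq_sum_flux (K := Finset.univ.sup K) h𝒳 hφ hTM hjumps
      hS hH htangent (fun y x hx => (hK y x hx).trans
        (by exact_mod_cast Finset.le_sup (f := K) (Finset.mem_univ y))) hnojump hp hV hSV hpcont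
    rwa [finrank_euclideanSpace_fin] at this
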